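/- For $\tau$ in the upper half-plane $\mathcal H$ put $L_\tau=\mathbb Z\oplus\tau\mathbb Z$. A function $f$ of $(\tau,z)\in\mathcal H\times\mathbb C$ (meromorphic in $z$, so that values at poles are disregarded: two functions are identified when they agree at all $(\tau,z)$ with $z\notin L_\tau$) is called singular if: (i) for every $\tau$, $z\mapsto f(\tau,z)$ is $1$-periodic and meromorphic on $\mathbb C$, its only possible poles are the points of $L_\tau$, and the orders of these poles are at most some $N$ that does not depend on $\tau$; (ii) $f(\tau+1,z)=f(\tau,z)$; (iii) for every $n\in\mathbb Z$ the $n$-th Laurent coefficient $A_n(\tau)$ of $z\mapsto f(\tau,z)$ at $z=0$ is holomorphic on $\mathcal H$ and at infinity, that is, it has an expansion $A_n(\tau)=\sum_{r\ge 0}\widehat A_n(r)e^{2\pi i r\tau}$. For $k\in\mathbb N$, a singular Jacobi form of weight $k$ and index $0$ is a singular function such that $$f\left(\frac{a\tau+b}{c\tau+d},\frac{z+\lambda\tau+\mu}{c\tau+d}\right)=(c\tau+d)^k f(\tau,z)$$ for all $\begin{pmatrix}a&b\\c&d\end{pmatrix}\in\mathrm{SL}(2,\mathbb Z)$ and $(\lambda,\mu)\in\mathbb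 Z^2$. Proposition 9. For every $k\in\mathbb N$ (with $0\in\mathbb N$), the complex vector space of singular Jacobi forms of weight $k$ and index $0$ is finite-dimensional, and its dimension is $$d_S(k)=\left\|\frac{(k+3\eta(k))^2}{48}\right\|,\qquad \eta(k)=\begin{cases}1&\text{if } k \text{ is odd},\\ 2&\text{if } k\text{ is even},\end{cases}$$ where $\|x\|$ is the integer nearest to the real number $x$ (with $\|n+1/2\|=n$ for $n\in\mathbb Z$). The generating function of these dimensions is the formal power series $$\sum_{k\in\mathbb N}d_S(k)z^k=\frac{1}{(1-z^2)(1-z^3)(1-z^4)},$$ and for all $k\in\mathbb N$ $$d_S(2k+3)=d_S(2k)\qquad\text{and}\qquad d_S(2k+13)=d_S(2k+1)+k+5.$$ The first values are $d_S(0)=1$, $d_S(1)=0$, $d_S(2)=1$, $d_S(4)=2$, $d_S(6)=3$, $d_S(8)=4$, $d_S(10)=5$, $d_S(12)=7$. -/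

import Mathlib

open UpperHalfPlane Filter Topology
open scoped MatrixGroups Manifold

noncomputable section

namespace SingularJacobi

/-- The lattice `ℤ ⊕ τℤ` of `ℂ` attached to a point `τ` of the upper half-plane. -/
def lattice (τ : ℍ) : Set ℂ :=
  {w | ∃ l m : ℤ, w = (l : ℂ) * (τ : ℂ) + (m : ℂ)}

/-- `a` is the family of Laurent coefficients of the meromorphic germ `g` at `0`. -/
def IsLaurentExpansionAtZero (g : ℂ → ℂ) (a : ℤ → ℂ) : Prop :=
  (∃ M : ℤ, ∀ n : ℤ, n < M → a n = 0) ∧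
    ∀ᶠ z in 𝓝[≠] (0 : ℂ), HasSum (fun n : ℤ => a n * z ^ n) (g z)

/-- `A` is holomorphic on the upper half-plane and at infinity: it has a Fourier expansion
`∑_{r ≥ 0} c r * e(r τ)`. -/
def IsHolomorphicWithCusp (A : ℍ → ℂ) : Prop :=
  MDifferentiable 𝓘(ℂ) 𝓘(ℂ) A ∧
    ∃ c : ℕ → ℂ, ∀ τ : ℍ,
      HasSum (fun r : ℕ => c r * Complex.exp (2 * Real.pi * Complex.I * r * (τ : ℂ))) (A τ)

/-- Singular functions of `(τ, z)`. A function which is meromorphic in `z` with poles in the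
lattice has no meaningful value at the lattice points, so no condition depends on the values
there. The pole orders are bounded uniformly (a pole of order at most `0` is no pole). -/
structure IsSingular (f : ℍ → ℂ → ℂ) : Prop where
  periodic_z : ∀ τ : ℍ, ∀ z ∉ lattice τ, f τ (z + 1) = f τ z
  holomorphic_off_lattice : ∀ τ : ℍ, DifferentiableOn ℂ (f τ) (lattice τ)ᶜ
  poles_on_lattice : ∃ N : ℕ, ∀ τ : ℍ, ∀ w ∈ lattice τ,
    MeromorphicAt (f τ) w ∧ ((-(N : ℤ) : ℤ) : WithTop ℤ) ≤ meromorphicOrderAt (f τ) w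
  periodic_tau : ∀ τ : ℍ, ∀ z ∉ lattice τ, f ((1 : ℝ) +ᵥ τ) z = f τ z
  laurent_coefficients : ∃ A : ℤ → ℍ → ℂ,
    (∀ τ : ℍ, IsLaurentExpansionAtZero (f τ) (fun n => A n τ)) ∧
      ∀ n : ℤ, IsHolomorphicWithCusp (A n)

/-- The weight `k`, index `m` action of the element `(g, (l, u))` of the Jacobi group
`SL(2, ℤ) ⋉ ℤ²` on functions of `(τ, z)`. -/
def jacobiSlash (k m : ℕ) (f : ℍ → ℂ → ℂ) (g : SL(2, ℤ)) (l u : ℤ) (τ : ℍ) (z : ℂ) : ℂ :=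
  (((g 1 0 : ℤ) : ℂ) * τ + ((g 1 1 : ℤ) : ℂ)) ^ (-(k : ℤ)) *
    Complex.exp (2 * Real.pi * Complex.I * m *
      (-(((g 1 0 : ℤ) : ℂ) * (z + l * τ + u) ^ 2 / (((g 1 0 : ℤ) : ℂ) * τ + ((g 1 1 : ℤ) : ℂ)))
        + (l : ℂ) ^ 2 * τ + 2 * l * z)) *
    f (g • τ) ((z + l * τ + u) / (((g 1 0 : ℤ) : ℂ) * τ + ((g 1 1 : ℤ) : ℂ)))

/-- Singular Jacobi forms of weight `k` and index `m`. -/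
structure IsSingularJacobiForm (k m : ℕ) (f : ℍ → ℂ → ℂ) : Prop where
  singular : IsSingular f
  slash_eq : ∀ (g : SL(2, ℤ)) (l u : ℤ) (τ : ℍ), ∀ z ∉ lattice τ,
    jacobiSlash k m f g l u τ z = f τ z

theorem IsHolomorphicWithCusp.zero : IsHolomorphicWithCusp (fun _ => 0) :=
  ⟨mdifferentiable_const, fun _ => 0, fun τ => by simp⟩

theorem IsHolomorphicWithCusp.add {A B : ℍ → ℂ} (hA : IsHolomorphicWithCusp A)
    (hB : IsHolomorphicWithCusp B) : IsHolomorphicWithCusp (fun τ => A τ + B τ) := by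
  obtain ⟨hA, c, hc⟩ := hA
  obtain ⟨hB, d, hd⟩ := hB
  refine ⟨hA.add hB, fun r => c r + d r, fun τ => ?_⟩
  simpa only [add_mul] using (hc τ).add (hd τ)

theorem IsHolomorphicWithCusp.smul {A : ℍ → ℂ} (t : ℂ) (hA : IsHolomorphicWithCusp A) :
    IsHolomorphicWithCusp (fun τ => t * A τ) := by
  obtain ⟨hA, c, hc⟩ := hA
  refine ⟨hA.const_smul t, fun r => t * c r, fun τ => ?_⟩
  simpa only [mul_assoc] using (hc τ).mul_left t

theorem IsSingular.zero : IsSingular (fun _ _ => 0) where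
  periodic_z _ _ _ := rfl
  holomorphic_off_lattice _ := differentiableOn_const _
  poles_on_lattice := ⟨0, fun τ w _ => ⟨MeromorphicAt.const 0 w, by
    have h : meromorphicOrderAt (fun _ : ℂ => (0 : ℂ)) w = ⊤ :=
      meromorphicOrderAt_eq_top_iff.2 (by simp)
    rw [h]; exact le_top⟩⟩
  periodic_tau _ _ _ := rfl
  laurent_coefficients := ⟨fun _ _ => 0,
    fun _ => ⟨⟨0, fun _ _ => rfl⟩, by simp⟩,
    fun _ => IsHolomorphicWithCusp.zero⟩

theorem IsSingular.add {f h : ℍ → ℂ → ℂ} (hf : IsSingular f) (hh : IsSingular h) :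
    IsSingular (f + h) where
  periodic_z τ z hz := by simp [hf.periodic_z τ z hz, hh.periodic_z τ z hz]
  holomorphic_off_lattice τ := (hf.holomorphic_off_lattice τ).add (hh.holomorphic_off_lattice τ)
  poles_on_lattice := by
    obtain ⟨N, hN⟩ := hf.poles_on_lattice
    obtain ⟨P, hP⟩ := hh.poles_on_lattice
    refine ⟨max N P, fun τ w hw => ⟨(hN τ w hw).1.add (hP τ w hw).1, ?_⟩⟩
    refine le_trans (le_min ?_ ?_) (meromorphicOrderAt_add (hN τ w hw).1 (hP τ w hw).1)
    · exact le_trans (WithTop.coe_le_coe.2 (by push_cast; omega)) (hN τ w hw).2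
    · exact le_trans (WithTop.coe_le_coe.2 (by push_cast; omega)) (hP τ w hw).2
  periodic_tau τ z hz := by simp [hf.periodic_tau τ z hz, hh.periodic_tau τ z hz]
  laurent_coefficients := by
    obtain ⟨A, hA, hA'⟩ := hf.laurent_coefficients
    obtain ⟨B, hB, hB'⟩ := hh.laurent_coefficients
    refine ⟨fun n τ => A n τ + B n τ, fun τ => ?_, fun n => (hA' n).add (hB' n)⟩
    obtain ⟨⟨M, hM⟩, hA1⟩ := hA τ
    obtain ⟨⟨P, hP⟩, hB1⟩ := hB τ
    refine ⟨⟨min M P, fun n hn => ?_⟩, ?_⟩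
    · have h1 := hM n (by omega)
      have h2 := hP n (by omega)
      simp only at h1 h2 ⊢
      rw [h1, h2, add_zero]
    · filter_upwards [hA1, hB1] with z h1 h2
      simpa only [add_mul, Pi.add_apply] using h1.add h2

theorem IsSingular.smul {f : ℍ → ℂ → ℂ} (t : ℂ) (hf : IsSingular f) :
    IsSingular (t • f) where
  periodic_z τ z hz := by simp [hf.periodic_z τ z hz]
  holomorphic_off_lattice τ := (hf.holomorphic_off_lattice τ).const_smul t
  poles_on_lattice := by
    obtain ⟨N, hN⟩ := hf.poles_on_lattice
    refine ⟨N, fun τ w hw => ?_⟩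
    have hc : MeromorphicAt (fun _ : ℂ => t) w := MeromorphicAt.const t w
    have e : (t • f) τ = (fun _ : ℂ => t) * f τ := rfl
    rw [e]
    refine ⟨hc.mul (hN τ w hw).1, ?_⟩
    rw [meromorphicOrderAt_mul hc (hN τ w hw).1]
    have h0 : 0 ≤ meromorphicOrderAt (fun _ : ℂ => t) w :=
      (analyticAt_const).meromorphicOrderAt_nonneg
    calc ((-(N : ℤ) : ℤ) : WithTop ℤ) = 0 + ((-(N : ℤ) : ℤ) : WithTop ℤ) := (zero_add _).symm
      _ ≤ _ := add_le_add h0 (hN τ w hw).2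
  periodic_tau τ z hz := by simp [hf.periodic_tau τ z hz]
  laurent_coefficients := by
    obtain ⟨A, hA, hA'⟩ := hf.laurent_coefficients
    refine ⟨fun n τ => t * A n τ, fun τ => ?_, fun n => (hA' n).smul t⟩
    obtain ⟨⟨M, hM⟩, hA1⟩ := hA τ
    refine ⟨⟨M, fun n hn => ?_⟩, ?_⟩
    · have h1 := hM n hn
      simp only at h1 ⊢
      rw [h1, mul_zero]
    · filter_upwards [hA1] with z h1
      simpa only [mul_assoc, Pi.smul_apply, smul_eq_mul] using h1.mul_left t

/-- The functions on `ℍ × ℂ` which are singular Jacobi forms of weight `k` and index `m`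
(with arbitrary values at the lattice points). -/
def singularJacobiFunctions (k m : ℕ) : Submodule ℂ (ℍ → ℂ → ℂ) where
  carrier := {f | IsSingularJacobiForm k m f}
  zero_mem' := ⟨IsSingular.zero, fun g l u τ z _ => by simp [jacobiSlash]⟩
  add_mem' {f h} hf hh := ⟨hf.singular.add hh.singular, fun g l u τ z hz => by
    have h1 := hf.slash_eq g l u τ z hz
    have h2 := hh.slash_eq g l u τ z hz
    simp only [jacobiSlash] at h1 h2
    simp only [jacobiSlash, Pi.add_apply]
    rw [mul_add, h1, h2]⟩
  smul_mem' t f hf := ⟨hf.singular.smul t, fun g l u τ z hz => by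
    have h1 := hf.slash_eq g l u τ z hz
    simp only [jacobiSlash] at h1
    simp only [jacobiSlash, Pi.smul_apply, smul_eq_mul]
    rw [mul_left_comm, h1]⟩

/-- The complement `{(τ, z) | z ∉ ℤ ⊕ τℤ}` of the lattice points in `ℍ × ℂ`. -/
abbrev PuncturedDomain : Type := {p : ℍ × ℂ // p.2 ∉ lattice p.1}

/-- Restriction of functions on `ℍ × ℂ` to the complement of the lattice points. -/
def restrict : (ℍ → ℂ → ℂ) →ₗ[ℂ] (PuncturedDomain → ℂ) where
  toFun f p := f p.1.1 p.1.2
  map_add' _ _ := rfl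
  map_smul' _ _ := rfl

/-- The complex vector space of singular Jacobi forms of weight `k` and index `m`: as usual for
meromorphic functions, two of them are equal when they agree off the lattice points. -/
def singularJacobiForms (k m : ℕ) : Submodule ℂ (PuncturedDomain → ℂ) :=
  (singularJacobiFunctions k m).map restrict

/-- The dimension of the space of singular Jacobi forms of weight `k` and index `0`. -/
def dS (k : ℕ) : ℕ := Module.finrank ℂ (singularJacobiForms k 0)

/-- The integer nearest to `x`, with `n + 1/2` sent to `n`. -/
def nearestInt (x : ℝ) : ℤ := ⌈x - 1 / 2⌉

/-- `1` for odd `k` and `2` for even `k`. -/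
def eta (k : ℕ) : ℕ := if Odd k then 1 else 2

end SingularJacobi

end

noncomputable section

namespace SingularJacobi

/-! For fixed τ, a form of weight k and index 0 is an elliptic function for ℤ ⊕ τℤ. Comparing
Laurent expansions at z = 0 on both sides of the transformation law shows that A_n is a level one
modular form of weight k + n (`coeff_smul`). There are none of negative weight, so A_n = 0 for n <
-k and the pole order is at most k.

Conversely, 1, ℘ and the normalised z-derivatives of ℘ give, for every N ≠ 1, a form φ_N of weight N
with principal part z⁻ᴺ (`exists_principal_part`). Order 1 is excluded because an elliptic function
with at most a simple pole at the lattice points has residue zero (`residue_eq_zero`). An elliptic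
function without poles is constant, so subtracting Σ A_{-N} φ_N over 2 ≤ N ≤ k from f leaves a
function of τ alone, namely a modular form of weight k. Hence (h_N) ↦ Σ h_N φ_N is an isomorphism
from the product of the spaces M_{k-N}, N ≤ k, N ≠ 1, onto the space of forms (`combinationEquiv`).

The dimension is therefore Σ dim M_{k-N}. Its generating function is (1/(1-z) - z) / ((1-z⁴)(1-z⁶)),
and 1/(1-z) - z = (1+z³)/(1-z²) turns this into the stated product. The numerical claims are checked
through the increment under k ↦ k + 12 (`poleOrderDim_add_twelve`) and finitely many values. -/

/-! ### Laurent expansions at the origin -/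

theorem hasSum_laurent_iff {a : ℤ → ℂ} {M : ℤ} (hM : ∀ n < M, a n = 0) {z s : ℂ} (hz : z ≠ 0) :
    HasSum (fun n : ℤ => a n * z ^ n) (z ^ M * s) ↔
      HasSum (fun i : ℕ => z ^ i • a (M + i)) s := by
  have hinj : Function.Injective (fun i : ℕ => M + (i : ℤ)) := fun i j h => by simpa using h
  rw [← hinj.hasSum_iff]
  · refine Iff.trans (iff_of_eq (congrArg₂ (fun u v => HasSum u v) ?_ rfl))
      (hasSum_mul_left_iff (zpow_ne_zero M hz))
    funext i
    simp only [Function.comp_apply, zpow_add₀ hz, zpow_natCast, smul_eq_mul]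
    ring
  · intro n hn
    rw [hM n, zero_mul]
    by_contra! h
    exact hn ⟨(n - M).toNat, by simp; omega⟩

/-- A Laurent expansion with no terms of degree less than `M` amounts to a power series expansion
after division by `z ^ M`. -/
theorem isLaurentExpansionAtZero_iff {g : ℂ → ℂ} {a : ℤ → ℂ} {M : ℤ} (hM : ∀ n < M, a n = 0) :
    IsLaurentExpansionAtZero g a ↔ ∃ F : ℂ → ℂ,
      HasFPowerSeriesAt F (.ofScalars ℂ fun i : ℕ => a (M + i)) 0 ∧
        ∀ᶠ z in 𝓝[≠] (0 : ℂ), g z = z ^ M * F z := by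
  constructor
  · rintro ⟨-, h⟩
    have key : ∀ᶠ z in 𝓝[≠] (0 : ℂ), HasSum (fun i : ℕ => z ^ i • a (M + i)) (z ^ (-M) * g z) := by
      filter_upwards [h, self_mem_nhdsWithin] with z hz hz0
      rw [← hasSum_laurent_iff hM hz0, ← mul_assoc, ← zpow_add₀ hz0]
      simpa using hz
    refine ⟨fun z => ∑' i : ℕ, z ^ i • a (M + i), ?_, ?_⟩
    · rw [hasFPowerSeriesAt_iff]
      simp only [FormalMultilinearSeries.coeff_ofScalars, zero_add]
      rw [eventually_nhdsWithin_iff] at key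
      filter_upwards [key] with z hz
      by_cases hz0 : z = 0
      · subst hz0
        refine Summable.hasSum (summable_of_ne_finset_zero (s := {0}) fun i hi => ?_)
        rw [zero_pow (by simpa using hi), zero_smul]
      · exact (hz hz0).summable.hasSum
    · filter_upwards [key, self_mem_nhdsWithin] with z hz hz0
      rw [hz.tsum_eq, ← mul_assoc, ← zpow_add₀ hz0]
      simp
  · rintro ⟨F, hF, hg⟩
    refine ⟨⟨M, hM⟩, ?_⟩
    rw [hasFPowerSeriesAt_iff] at hF
    filter_upwards [hg, self_mem_nhdsWithin, hF.filter_mono nhdsWithin_le_nhds] with z hz hz0 h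
    rw [hz, hasSum_laurent_iff hM hz0]
    simpa [FormalMultilinearSeries.coeff_ofScalars] using h

theorem IsLaurentExpansionAtZero.congr {g h : ℂ → ℂ} {a : ℤ → ℂ}
    (hg : IsLaurentExpansionAtZero g a) (e : h =ᶠ[𝓝[≠] 0] g) : IsLaurentExpansionAtZero h a :=
  ⟨hg.1, by filter_upwards [hg.2, e] with z h1 h2; rwa [h2]⟩

theorem IsLaurentExpansionAtZero.add {g h : ℂ → ℂ} {a b : ℤ → ℂ}
    (hg : IsLaurentExpansionAtZero g a) (hh : IsLaurentExpansionAtZero h b) :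
    IsLaurentExpansionAtZero (fun z => g z + h z) (fun n => a n + b n) := by
  obtain ⟨⟨M, hM⟩, hA1⟩ := hg
  obtain ⟨⟨P, hP⟩, hB1⟩ := hh
  refine ⟨⟨min M P, fun n hn => ?_⟩, ?_⟩
  · simp only [hM n (by omega), hP n (by omega), add_zero]
  · filter_upwards [hA1, hB1] with z h1 h2
    simpa only [add_mul] using h1.add h2

theorem IsLaurentExpansionAtZero.const_mul {g : ℂ → ℂ} {a : ℤ → ℂ} (t : ℂ)
    (hg : IsLaurentExpansionAtZero g a) :
    IsLaurentExpansionAtZero (fun z => t * g z) (fun n => t * a n) := by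
  obtain ⟨⟨M, hM⟩, hA1⟩ := hg
  refine ⟨⟨M, fun n hn => by simp only [hM n hn, mul_zero]⟩, ?_⟩
  filter_upwards [hA1] with z h1
  simpa only [mul_assoc] using h1.mul_left t

theorem IsLaurentExpansionAtZero.zero :
    IsLaurentExpansionAtZero (fun _ => 0) (fun _ => 0) :=
  ⟨⟨0, fun _ _ => rfl⟩, by simp⟩

theorem IsLaurentExpansionAtZero.comp_div {g : ℂ → ℂ} {a : ℤ → ℂ} {c : ℂ} (hc : c ≠ 0)
    (hg : IsLaurentExpansionAtZero g a) :
    IsLaurentExpansionAtZero (fun z => g (z / c)) (fun n => a n * c ^ (-n)) := by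
  obtain ⟨⟨M, hM⟩, hA1⟩ := hg
  refine ⟨⟨M, fun n hn => by simp only [hM n hn, zero_mul]⟩, ?_⟩
  have ht : Tendsto (fun z : ℂ => z / c) (𝓝[≠] 0) (𝓝[≠] 0) := by
    refine tendsto_nhdsWithin_iff.2 ⟨?_, ?_⟩
    · have : ContinuousAt (fun z : ℂ => z / c) 0 := by fun_prop
      simpa [ContinuousAt] using this.mono_left (nhdsWithin_le_nhds (s := {(0 : ℂ)}ᶜ))
    · filter_upwards [self_mem_nhdsWithin] with z hz
      exact div_ne_zero hz hc
  filter_upwards [ht.eventually hA1] with z hz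
  convert! hz using 2 with n
  rw [div_zpow, zpow_neg]
  ring

/-- After division by a common power of z, both expansions are power series of analytic functions
that agree on a punctured neighbourhood, so the identity theorem applies. -/
theorem IsLaurentExpansionAtZero.unique {g : ℂ → ℂ} {a b : ℤ → ℂ}
    (ha : IsLaurentExpansionAtZero g a) (hb : IsLaurentExpansionAtZero g b) : a = b := by
  obtain ⟨M, hM⟩ := ha.1
  obtain ⟨P, hP⟩ := hb.1
  have hM' : ∀ n < min M P, a n = 0 := fun n hn => hM n (by omega)
  have hP' : ∀ n < min M P, b n = 0 := fun n hn => hP n (by omega)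
  obtain ⟨F, hF, hFg⟩ := (isLaurentExpansionAtZero_iff hM').1 ha
  obtain ⟨G, hG, hGg⟩ := (isLaurentExpansionAtZero_iff hP').1 hb
  have e : F =ᶠ[𝓝[≠] 0] G := by
    filter_upwards [hFg, hGg, self_mem_nhdsWithin] with z h1 h2 hz
    exact mul_left_cancel₀ (zpow_ne_zero _ hz) (h1.symm.trans h2)
  have e' := (hF.analyticAt.frequently_eq_iff_eventually_eq hG.analyticAt).1 e.frequently
  have h := hF.eq_formalMultilinearSeries_of_eventually hG e'
  have h' := FormalMultilinearSeries.ofScalars_series_injective ℂ ℂ h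
  funext n
  by_cases hn : n < min M P
  · rw [hM' n hn, hP' n hn]
  · have := congrFun h' (n - min M P).toNat
    simpa [Int.toNat_of_nonneg (show 0 ≤ n - min M P by omega)] using this

theorem meromorphicOrderAt_ge_of_eventually_eq {g F : ℂ → ℂ} {w : ℂ} {M : ℤ}
    (hF : AnalyticAt ℂ F w) (h : ∀ᶠ z in 𝓝[≠] w, g z = (z - w) ^ M * F z) :
    MeromorphicAt g w ∧ (M : WithTop ℤ) ≤ meromorphicOrderAt g w := by
  have h1 : MeromorphicAt ((· - w) ^ M) w := by fun_prop
  have e : g =ᶠ[𝓝[≠] w] (· - w) ^ M * F := h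
  refine ⟨(h1.mul hF.meromorphicAt).congr e.symm, ?_⟩
  rw [meromorphicOrderAt_congr e, meromorphicOrderAt_mul h1 hF.meromorphicAt,
    meromorphicOrderAt_zpow_id_sub_const]
  calc (M : WithTop ℤ) = M + 0 := (add_zero _).symm
    _ ≤ _ := by gcongr; exact hF.meromorphicOrderAt_nonneg

theorem IsLaurentExpansionAtZero.meromorphicOrderAt_ge {g : ℂ → ℂ} {a : ℤ → ℂ} {M : ℤ}
    (h : IsLaurentExpansionAtZero g a) (hM : ∀ n < M, a n = 0) :
    MeromorphicAt g 0 ∧ (M : WithTop ℤ) ≤ meromorphicOrderAt g 0 := by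
  obtain ⟨F, hF, hg⟩ := (isLaurentExpansionAtZero_iff hM).1 h
  exact meromorphicOrderAt_ge_of_eventually_eq hF.analyticAt (by simpa using hg)

theorem hasFPowerSeriesAt_deriv {F : ℂ → ℂ} {b : ℕ → ℂ}
    (hF : HasFPowerSeriesAt F (.ofScalars ℂ b) 0) :
    HasFPowerSeriesAt (deriv F) (.ofScalars ℂ fun i => (i + 1) * b (i + 1)) 0 := by
  obtain ⟨r, hr⟩ := hF
  have h1 := hr.fderiv
  have h2 := (ContinuousLinearMap.apply ℂ ℂ (1 : ℂ)).comp_hasFPowerSeriesOnBall h1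
  have h3 := h2.hasFPowerSeriesAt
  rw [hasFPowerSeriesAt_iff] at h3 ⊢
  filter_upwards [h3] with z hz
  convert! hz using 2 with i
  have := (FormalMultilinearSeries.ofScalars ℂ b).derivSeries_coeff_one i
  rw [FormalMultilinearSeries.coeff_ofScalars] at this ⊢
  refine congrArg (z ^ i • ·) (Eq.trans ?_ this.symm)
  simp

theorem IsLaurentExpansionAtZero.deriv {g : ℂ → ℂ} {a : ℤ → ℂ}
    (h : IsLaurentExpansionAtZero g a) :
    IsLaurentExpansionAtZero (deriv g) (fun n => ((n : ℂ) + 1) * a (n + 1)) := by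
  obtain ⟨M, hM⟩ := h.1
  obtain ⟨F, hF, hg⟩ := (isLaurentExpansionAtZero_iff hM).1 h
  have hM' : ∀ n < M - 1, ((n : ℂ) + 1) * a (n + 1) = 0 := fun n hn => by
    rw [hM _ (by omega), mul_zero]
  -- The derivative of z^M F is z^(M-1) (M F + z F').
  refine (isLaurentExpansionAtZero_iff hM').2 ⟨fun z => M * F z + z * _root_.deriv F z, ?_, ?_⟩
  · have hd := hasFPowerSeriesAt_deriv hF
    rw [hasFPowerSeriesAt_iff] at hF hd ⊢
    filter_upwards [hF, hd] with z h1 h2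
    simp only [FormalMultilinearSeries.coeff_ofScalars, zero_add, smul_eq_mul] at h1 h2 ⊢
    have h3 : HasSum (fun i : ℕ => z ^ i * (i * a (M + i))) (z * _root_.deriv F z) := by
      rw [← hasSum_nat_add_iff' 1]
      convert! h2.mul_left z using 1
      · funext i; push_cast; ring
      · simp
    convert! (h1.mul_left (M : ℂ)).add h3 using 1
    funext i
    rw [show M - 1 + (i : ℤ) + 1 = M + i by ring]
    push_cast
    ring
  · obtain ⟨U, hU, hUo, h0⟩ := eventually_nhds_iff.1 (eventually_nhdsWithin_iff.1 hg)
    filter_upwards [self_mem_nhdsWithin, nhdsWithin_le_nhds (hUo.mem_nhds h0),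
      nhdsWithin_le_nhds hF.analyticAt.eventually_analyticAt] with z hz hzU hFz
    have e : g =ᶠ[𝓝 z] fun y => y ^ M * F y := by
      filter_upwards [hUo.mem_nhds hzU, isOpen_ne.mem_nhds hz] with y hy hy0 using hU y hy hy0
    have h1 : HasDerivAt (fun y : ℂ => y ^ M * F y)
        ((M : ℂ) * z ^ (M - 1) * F z + z ^ M * _root_.deriv F z) z :=
      (hasDerivAt_zpow M z (Or.inl hz)).mul hFz.differentiableAt.hasDerivAt
    rw [e.deriv_eq, h1.deriv, zpow_sub_one₀ hz]
    have : z ≠ 0 := hz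
    field_simp

/-! ### Arithmetic of the dimension formula -/

/-- The dimension of the space of level one modular forms of weight `j`. -/
def modularDim (j : ℕ) : ℕ := if Odd j then 0 else if j % 12 = 2 then j / 12 else j / 12 + 1

/-- The sum of the dimensions of the spaces of modular forms of weight `k - N`, where `N` runs
through the pole orders of elliptic functions. -/
def poleOrderDim (k : ℕ) : ℕ := ∑ N ∈ (Finset.range (k + 1)).erase 1, modularDim (k - N)

theorem modularDim_add_twelve (j : ℕ) :
    modularDim (j + 12) = modularDim j + if Odd j then 0 else 1 := by
  unfold modularDim
  simp only [Nat.odd_iff]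
  split_ifs <;> omega

theorem sum_modularDim_add_twelve (k : ℕ) :
    ∑ j ∈ Finset.range (k + 13), modularDim j
      = ∑ j ∈ Finset.range (k + 1), modularDim j + (6 + k / 2) := by
  induction k with
  | zero => decide +kernel
  | succ k ih =>
    rw [show k + 1 + 13 = (k + 13) + 1 by ring, Finset.sum_range_succ, ih,
      Finset.sum_range_succ _ (k + 1), show k + 13 = (k + 1) + 12 by ring, modularDim_add_twelve]
    simp only [Nat.odd_iff]
    split_ifs <;> omega

/-- Substituting j = k + 1 - N turns the sum into one over all weights; the omitted order N = 1 is
the term of weight k. -/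
theorem poleOrderDim_succ (k : ℕ) :
    poleOrderDim (k + 1) + modularDim k = ∑ j ∈ Finset.range (k + 2), modularDim j := by
  rw [poleOrderDim, ← Finset.sum_range_reflect, ← Finset.sum_erase_add _ _
    (show 1 ∈ Finset.range (k + 2) by simp)]
  refine congrArg₂ _ (Finset.sum_congr rfl fun N _ => ?_) ?_ <;> congr 1

/-- Every later numerical identity follows by induction in steps of 12 from this increment. It
equals the change of (k + 3η)²/48, namely (k + 3η)/2 + 3, which is an integer for either parity. -/
theorem poleOrderDim_add_twelve (k : ℕ) :
    poleOrderDim (k + 12) = poleOrderDim k + if Odd k then (k + 9) / 2 else k / 2 + 6 := by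
  rcases k with _ | k
  · decide +kernel
  · have h1 := poleOrderDim_succ k
    have h2 := poleOrderDim_succ (k + 12)
    have h3 : ∑ j ∈ Finset.range (k + 1 + 13), modularDim j
      = ∑ j ∈ Finset.range (k + 2), modularDim j + (6 + (k + 1) / 2) :=
      sum_modularDim_add_twelve (k + 1)
    have h4 := modularDim_add_twelve k
    rw [show k + 12 + 2 = k + 1 + 13 by ring, h3] at h2
    rw [show k + 1 + 12 = k + 12 + 1 by ring]
    rcases Nat.even_or_odd' k with ⟨m, rfl | rfl⟩
    · rw [if_neg (by simp)] at h4
      rw [if_pos (by simp)]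
      omega
    · rw [if_pos (by simp)] at h4
      rw [if_neg (by rw [Nat.odd_iff]; omega)]
      omega

theorem induction_add_twelve {P : ℕ → Prop} (h0 : ∀ k < 12, P k) (h : ∀ k, P k → P (k + 12))
    (k : ℕ) : P k := by
  induction k using Nat.strong_induction_on with
  | _ k ih =>
    by_cases hk : k < 12
    · exact h0 k hk
    · have := h (k - 12) (ih _ (by omega))
      rwa [Nat.sub_add_cancel (by omega)] at this

theorem nearestInt_add_intCast (x : ℝ) (n : ℤ) : nearestInt (x + n) = nearestInt x + n := by
  rw [nearestInt, nearestInt, ← Int.ceil_add_intCast]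
  congr 1
  ring

theorem poleOrderDim_eq_nearestInt (k : ℕ) :
    (poleOrderDim k : ℤ) = nearestInt (((k : ℝ) + 3 * (eta k : ℝ)) ^ 2 / 48) := by
  induction k using induction_add_twelve with
  | h0 k hk =>
    symm
    rw [nearestInt, Int.ceil_eq_iff]
    have v : ∀ k < 12, poleOrderDim k = [1, 0, 1, 1, 2, 1, 3, 2, 4, 3, 5, 4].getD k 0 := by
      decide +kernel
    rw [v k hk]
    interval_cases k <;> norm_num [eta, Nat.odd_iff]
  | h k ih =>
    rw [poleOrderDim_add_twelve, Nat.cast_add, ih, ← nearestInt_add_intCast]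
    congr 1
    rcases Nat.even_or_odd' k with ⟨m, rfl | rfl⟩
    · have h1 : ¬ Odd (2 * m) := by simp
      have h2 : ¬ Odd (2 * m + 12) := by rw [Nat.odd_iff]; omega
      simp only [eta, if_neg h1, if_neg h2, Nat.mul_div_cancel_left m two_pos]
      push_cast
      ring
    · have h1 : Odd (2 * m + 1) := by simp
      have h2 : Odd (2 * m + 1 + 12) := by rw [Nat.odd_iff]; omega
      simp only [eta, if_pos h1, if_pos h2, show (2 * m + 1 + 9) / 2 = m + 5 by omega]
      push_cast
      ring

/-- This is the linear recurrence whose characteristic polynomial is (1-z²)(1-z³)(1-z⁴), with the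
negative terms moved to the other side. -/
theorem poleOrderDim_recurrence (k : ℕ) :
    poleOrderDim (k + 9) + poleOrderDim (k + 4) + poleOrderDim (k + 3) + poleOrderDim (k + 2) =
      poleOrderDim (k + 7) + poleOrderDim (k + 6) + poleOrderDim (k + 5) + poleOrderDim k := by
  induction k using induction_add_twelve with
  | h0 k hk => revert k; decide +kernel
  | h k ih =>
    simp only [add_right_comm k 12, poleOrderDim_add_twelve, Nat.odd_iff]
    generalize poleOrderDim (k + 9) = x9 at *
    generalize poleOrderDim (k + 7) = x7 at *
    generalize poleOrderDim (k + 6) = x6 at *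
    generalize poleOrderDim (k + 5) = x5 at *
    generalize poleOrderDim (k + 4) = x4 at *
    generalize poleOrderDim (k + 3) = x3 at *
    generalize poleOrderDim (k + 2) = x2 at *
    generalize poleOrderDim k = x0 at *
    rcases Nat.even_or_odd' k with ⟨m, rfl | rfl⟩ <;> simp +arith [Nat.add_mod] <;> omega

theorem poleOrderDim_two_mul_add_three (k : ℕ) :
    poleOrderDim (2 * k + 3) = poleOrderDim (2 * k) := by
  suffices h : ∀ n, Even n → poleOrderDim (n + 3) = poleOrderDim n from h _ (by simp)
  intro n
  induction n using induction_add_twelve with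
  | h0 n hn => revert n; decide +kernel
  | h n ih =>
    intro h
    rw [Nat.even_iff] at *
    have := ih (by omega)
    simp only [add_right_comm n 12, poleOrderDim_add_twelve, Nat.odd_iff]
    split_ifs <;> omega

theorem poleOrderDim_two_mul_add_thirteen (k : ℕ) :
    poleOrderDim (2 * k + 13) = poleOrderDim (2 * k + 1) + k + 5 := by
  rw [show 2 * k + 13 = 2 * k + 1 + 12 by ring, poleOrderDim_add_twelve, if_pos (by simp)]
  omega

theorem mk_poleOrderDim :
    PowerSeries.mk (fun k : ℕ => (poleOrderDim k : ℚ)) =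
      ((1 - PowerSeries.X ^ 2) * (1 - PowerSeries.X ^ 3) * (1 - PowerSeries.X ^ 4))⁻¹ := by
  rw [PowerSeries.eq_inv_iff_mul_eq_one (by simp)]
  have e : (1 - PowerSeries.X ^ 2) * (1 - PowerSeries.X ^ 3) * (1 - PowerSeries.X ^ 4) =
    (1 - PowerSeries.X ^ 2 - PowerSeries.X ^ 3 - PowerSeries.X ^ 4 + PowerSeries.X ^ 5
      + PowerSeries.X ^ 6 + PowerSeries.X ^ 7 - PowerSeries.X ^ 9 : PowerSeries ℚ) := by ring
  rw [e]
  ext n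
  simp only [mul_sub, mul_add, mul_one, map_sub, map_add, PowerSeries.coeff_mul_X_pow',
    PowerSeries.coeff_mk, PowerSeries.coeff_one]
  have v : poleOrderDim 0 = 1 ∧ poleOrderDim 1 = 0 ∧ poleOrderDim 2 = 1 ∧ poleOrderDim 3 = 1 ∧
      poleOrderDim 4 = 2 ∧ poleOrderDim 5 = 1 ∧ poleOrderDim 6 = 3 ∧ poleOrderDim 7 = 2 ∧
      poleOrderDim 8 = 4 := by decide +kernel
  obtain ⟨v0, v1, v2, v3, v4, v5, v6, v7, v8⟩ := v
  by_cases hn : n < 9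
  · interval_cases n <;> norm_num [*]
  · obtain ⟨m, rfl⟩ := Nat.exists_eq_add_of_le (not_lt.1 hn)
    have h := poleOrderDim_recurrence m
    have h' : (poleOrderDim (m + 9) : ℚ) + poleOrderDim (m + 4) + poleOrderDim (m + 3)
      + poleOrderDim (m + 2) = poleOrderDim (m + 7) + poleOrderDim (m + 6) + poleOrderDim (m + 5)
      + poleOrderDim m := by exact_mod_cast h
    rw [if_pos (by omega), if_pos (by omega), if_pos (by omega), if_pos (by omega),
      if_pos (by omega), if_pos (by omega), if_pos (by omega), if_neg (by omega),
      show 9 + m = m + 9 by ring, show m + 9 - 2 = m + 7 by omega, show m + 9 - 3 = m + 6 by omega,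
      show m + 9 - 4 = m + 5 by omega, show m + 9 - 5 = m + 4 by omega,
      show m + 9 - 6 = m + 3 by omega, show m + 9 - 7 = m + 2 by omega,
      show m + 9 - 9 = m by omega]
    linarith

/-! ### Elliptic functions: Liouville's theorem and the residue at the origin -/

theorem tendsto_sub_punctured (x l : ℂ) :
    Tendsto (fun y : ℂ => y - l) (𝓝[≠] (x + l)) (𝓝[≠] x) := by
  refine tendsto_nhdsWithin_iff.2 ⟨?_, ?_⟩
  · have : ContinuousAt (fun y : ℂ => y - l) (x + l) := by fun_prop
    simpa [ContinuousAt] using this.mono_left (nhdsWithin_le_nhds (s := {x + l}ᶜ))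
  · filter_upwards [self_mem_nhdsWithin] with y hy h
    exact hy (by simp_all [sub_eq_iff_eq_add])

theorem tendsto_add_punctured (x l : ℂ) :
    Tendsto (fun y : ℂ => y + l) (𝓝[≠] x) (𝓝[≠] (x + l)) := by
  simpa using tendsto_sub_punctured (x + l) (-l)

theorem tendsto_punctured_of_analyticAt {F : ℂ → ℂ} {x : ℂ} (hF : AnalyticAt ℂ F x) :
    Tendsto F (𝓝[≠] x) (𝓝 (F x)) :=
  hF.continuousAt.tendsto.mono_left nhdsWithin_le_nhds

/-- A meromorphic function without poles which is periodic for a lattice is constant. -/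
theorem exists_eventually_eq_const (L : PeriodPair) {g : ℂ → ℂ} (hm : ∀ x, MeromorphicAt g x)
    (ho : ∀ x, 0 ≤ meromorphicOrderAt g x) (hp : ∀ z, ∀ l ∈ L.lattice, g (z + l) = g z) :
    ∃ c, ∀ x, ∀ᶠ z in 𝓝[≠] x, g z = c := by
  choose F hF hg using fun x => ((hm x).meromorphicOrderAt_nonneg_iff).1 (ho x)
  -- Taking limits fills in the removable singularities: near each x, `G` agrees with the local
  -- analytic representative, also at x itself.
  set G : ℂ → ℂ := fun x => limUnder (𝓝[≠] x) g with hG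
  have hGF : ∀ x, ∀ᶠ y in 𝓝 x, G y = F x y := by
    intro x
    have h1 := eventually_eventually_nhdsWithin.2 (hg x)
    have h2 : ∀ᶠ y in 𝓝[≠] x, G y = F x y := by
      filter_upwards [nhdsWithin_le_nhds (hF x).eventually_analyticAt, h1,
        self_mem_nhdsWithin] with y hy hy' hyx
      refine Tendsto.limUnder_eq ((tendsto_punctured_of_analyticAt hy).congr' ?_)
      have h3 : ∀ᶠ z in 𝓝 y, g z = F x z := by
        rwa [nhdsWithin_eq_nhds.2 (isOpen_compl_singleton.mem_nhds hyx)] at hy'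
      exact (h3.filter_mono nhdsWithin_le_nhds).mono fun z hz => hz.symm
    have h3 : G x = F x x :=
      Tendsto.limUnder_eq ((tendsto_punctured_of_analyticAt (hF x)).congr' ((hg x).mono fun z hz => hz.symm))
    rw [eventually_nhdsWithin_iff] at h2
    filter_upwards [h2] with y hy
    by_cases hyx : y = x
    · rw [hyx, h3]
    · exact hy hyx
  have hd : Differentiable ℂ G := fun x =>
    ((hF x).differentiableAt).congr_of_eventuallyEq (hGF x)
  have hper : ∀ z l, l ∈ L.lattice → G (z + l) = G z := by
    intro z l hl
    have h1 : Tendsto g (𝓝[≠] z) (𝓝 (F z z)) :=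
      (tendsto_punctured_of_analyticAt (hF z)).congr' ((hg z).mono fun z hz => hz.symm)
    have h2 : Tendsto g (𝓝[≠] (z + l)) (𝓝 (F z z)) := by
      refine (h1.comp (tendsto_sub_punctured z l)).congr fun y => ?_
      rw [Function.comp_apply, ← hp (y - l) l hl, sub_add_cancel]
    rw [hG]
    exact h2.limUnder_eq.trans h1.limUnder_eq.symm
  -- A continuous function periodic for a lattice has compact range, so Liouville's theorem applies.
  have hc : ∀ x, G x = G 0 := fun x => hd.apply_eq_apply_of_bounded
    (IsZLattice.isCompact_range_of_periodic L.lattice _ hd.continuous hper).isBounded x 0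
  refine ⟨G 0, fun x => ?_⟩
  filter_upwards [hg x, nhdsWithin_le_nhds (hGF x)] with z h1 h2
  rw [h1, ← h2, hc z]

theorem meromorphicAt_comp_add {g : ℂ → ℂ} {x w : ℂ} (h : MeromorphicAt g (x + w)) :
    MeromorphicAt (fun z => g (z + w)) x := by
  have hw : AnalyticAt ℂ (fun z : ℂ => z + w) x := by fun_prop
  exact MeromorphicAt.comp_analyticAt (g := fun z : ℂ => z + w) h hw

theorem meromorphicOrderAt_comp_add {g : ℂ → ℂ} {x w : ℂ} :
    meromorphicOrderAt (fun z => g (z + w)) x = meromorphicOrderAt g (x + w) := by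
  have hw : AnalyticAt ℂ (fun z : ℂ => z + w) x := by fun_prop
  exact meromorphicOrderAt_comp_of_deriv_ne_zero hw (by simp)

section Elliptic

variable {L : PeriodPair} {g : ℂ → ℂ}

theorem isOpen_compl_lattice (L : PeriodPair) : IsOpen ((L.lattice : Set ℂ)ᶜ) :=
  L.isClosed_lattice.isOpen_compl

theorem eventually_notMem_lattice (L : PeriodPair) (x : ℂ) :
    ∀ᶠ z in 𝓝[≠] x, z ∉ L.lattice := by
  filter_upwards [self_mem_nhdsWithin, mem_nhdsWithin_of_mem_nhds
    (L.compl_lattice_sdiff_singleton_mem_nhds x)] with w hw hw'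
  simp_all

theorem eventually_periodic_germ (hper : ∀ z ∉ L.lattice, ∀ l ∈ L.lattice, g (z + l) = g z)
    {w : ℂ} (hw : w ∈ L.lattice) : (fun z => g (z + w)) =ᶠ[𝓝[≠] 0] g := by
  filter_upwards [eventually_notMem_lattice L 0] with z hz using hper z hz w hw

theorem meromorphicAt_of_periodic (hper : ∀ z ∉ L.lattice, ∀ l ∈ L.lattice, g (z + l) = g z)
    (h0 : MeromorphicAt g 0) {w : ℂ} (hw : w ∈ L.lattice) : MeromorphicAt g w := by
  have h1 : MeromorphicAt g (w + -w) := by simpa using h0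
  refine (meromorphicAt_comp_add h1).congr ?_
  filter_upwards [eventually_notMem_lattice L w] with z hz using hper z hz _ (neg_mem hw)

theorem meromorphicOrderAt_of_periodic
    (hper : ∀ z ∉ L.lattice, ∀ l ∈ L.lattice, g (z + l) = g z) {w : ℂ} (hw : w ∈ L.lattice) :
    meromorphicOrderAt g w = meromorphicOrderAt g 0 := by
  rw [← meromorphicOrderAt_congr (eventually_periodic_germ hper hw), meromorphicOrderAt_comp_add,
    zero_add]

/-- An elliptic function without poles is constant off the lattice. -/
theorem exists_eq_const_of_order_nonneg (hol : DifferentiableOn ℂ g (L.lattice : Set ℂ)ᶜ)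
    (hper : ∀ z ∉ L.lattice, ∀ l ∈ L.lattice, g (z + l) = g z)
    (h0 : MeromorphicAt g 0) (ho : 0 ≤ meromorphicOrderAt g 0) :
    ∃ c, ∀ z ∉ L.lattice, g z = c := by
  classical
  -- The values of `g` on the lattice are arbitrary; replacing them by 0 makes periodicity hold
  -- everywhere.
  set e : ℂ → ℂ := fun z => if z ∈ L.lattice then 0 else g z with he
  have hge : ∀ x, g =ᶠ[𝓝[≠] x] e := fun x => by
    filter_upwards [eventually_notMem_lattice L x] with z hz
    rw [he]
    simp [hz]
  have han : ∀ x ∉ L.lattice, AnalyticAt ℂ g x := fun x hx =>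
    hol.analyticAt ((isOpen_compl_lattice L).mem_nhds hx)
  have hme : ∀ x, MeromorphicAt e x := fun x => by
    refine MeromorphicAt.congr ?_ (hge x)
    by_cases hx : x ∈ L.lattice
    · exact meromorphicAt_of_periodic hper h0 hx
    · exact (han x hx).meromorphicAt
  have hoe : ∀ x, 0 ≤ meromorphicOrderAt e x := fun x => by
    rw [← meromorphicOrderAt_congr (hge x)]
    by_cases hx : x ∈ L.lattice
    · rwa [meromorphicOrderAt_of_periodic hper hx]
    · exact (han x hx).meromorphicOrderAt_nonneg
  have hpe : ∀ z, ∀ l ∈ L.lattice, e (z + l) = e z := by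
    intro z l hl
    have h1 : z + l ∈ L.lattice ↔ z ∈ L.lattice := Submodule.add_mem_iff_left _ hl
    simp only [he, h1]
    split_ifs with hz
    · rfl
    · exact hper z hz l hl
  obtain ⟨c, hc⟩ := exists_eventually_eq_const L hme hoe hpe
  refine ⟨c, fun z hz => ?_⟩
  have h1 := tendsto_punctured_of_analyticAt (han z hz)
  have h2 : Tendsto g (𝓝[≠] z) (𝓝 c) := by
    refine tendsto_const_nhds.congr' ?_
    filter_upwards [hge z, hc z] with y h1 h2
    rw [h1, h2]
  exact tendsto_nhds_unique h1 h2

/-- An odd elliptic function has no simple pole at the origin. -/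
theorem meromorphicOrderAt_ne_neg_one_of_odd {o : ℂ → ℂ}
    (hol : DifferentiableOn ℂ o (L.lattice : Set ℂ)ᶜ)
    (hper : ∀ z, ∀ l ∈ L.lattice, o (z + l) = o z) (hodd : ∀ z, o (-z) = -o z) :
    meromorphicOrderAt o 0 ≠ ((-1 : ℤ) : WithTop ℤ) := by
  intro hord
  have hm0 : MeromorphicAt o 0 :=
    meromorphicAt_of_meromorphicOrderAt_ne_zero (by rw [hord]; decide)
  have hper' : ∀ z ∉ L.lattice, ∀ l ∈ L.lattice, o (z + l) = o z := fun z _ => hper z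
  have han : ∀ x ∉ L.lattice, AnalyticAt ℂ o x := fun x hx =>
    hol.analyticAt ((isOpen_compl_lattice L).mem_nhds hx)
  have hm : ∀ x, MeromorphicAt o x := fun x => by
    by_cases hx : x ∈ L.lattice
    · exact meromorphicAt_of_periodic hper' hm0 hx
    · exact (han x hx).meromorphicAt
  have hL : ∀ x ∈ L.lattice, meromorphicOrderAt o x = ((-1 : ℤ) : WithTop ℤ) := fun x hx =>
    (meromorphicOrderAt_of_periodic hper' hx).trans hord
  have hne : ∀ x, meromorphicOrderAt o x ≠ ⊤ := fun x =>
    MeromorphicOn.meromorphicOrderAt_ne_top_of_isPreconnected (U := Set.univ) (x := 0)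
      (fun x _ => hm x) isPreconnected_univ (Set.mem_univ _) (Set.mem_univ _)
      (by rw [hord]; exact WithTop.coe_ne_top)
  -- At a half period x, periodicity and oddness give o(x) = o(-x) = -o(x), so x is a zero.
  have hhalf : ∀ x ∉ L.lattice, x + x ∈ L.lattice →
      ((1 : ℤ) : WithTop ℤ) ≤ meromorphicOrderAt o x := by
    intro x hx h2x
    have hz : o x = 0 := by
      have h1 := hper (-x) _ h2x
      rw [neg_add_cancel_left, hodd] at h1
      linear_combination h1 / 2
    rw [(han x hx).meromorphicOrderAt_eq]
    have h1 : 1 ≤ analyticOrderAt o x :=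
      Order.one_le_iff_ne_zero.2 ((han x hx).analyticOrderAt_ne_zero.2 hz)
    simpa using ENat.monotone_map_iff.2 Nat.mono_cast h1
  -- For a half period w, the simple poles of each factor of o(z) o(z + w) lie at zeros of the
  -- other, so the product has no poles and is constant.
  have key : ∀ w ∉ L.lattice, w + w ∈ L.lattice →
      ∃ c, ∀ x, ∀ᶠ z in 𝓝[≠] x, o z * o (z + w) = c := by
    intro w hw h2w
    refine exists_eventually_eq_const L (g := o * fun z => o (z + w))
      (fun x => (hm x).mul (meromorphicAt_comp_add (hm _))) (fun x => ?_) (fun z l hl => ?_)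
    · rw [meromorphicOrderAt_mul (hm x) (meromorphicAt_comp_add (hm _)),
        meromorphicOrderAt_comp_add]
      by_cases hx : x ∈ L.lattice
      · have h1 : x + w ∉ L.lattice := fun h => hw ((Submodule.add_mem_iff_right _ hx).1 h)
        have h2 := hhalf (x + w) h1 (by
          rw [show x + w + (x + w) = (x + x) + (w + w) by ring]
          exact add_mem (add_mem hx hx) h2w)
        rw [hL x hx]
        exact (by decide : (0 : WithTop ℤ) ≤ ((-1 : ℤ) : WithTop ℤ) + ((1 : ℤ) : WithTop ℤ)).trans
          (add_le_add le_rfl h2)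
      · by_cases hxw : x + w ∈ L.lattice
        · have h2 := hhalf x hx (by
            rw [show x + x = (x + w) + (x + w) - (w + w) by ring]
            exact sub_mem (add_mem hxw hxw) h2w)
          rw [hL _ hxw]
          exact (by decide : (0 : WithTop ℤ) ≤ ((1 : ℤ) : WithTop ℤ) + ((-1 : ℤ) : WithTop ℤ)).trans
            (add_le_add h2 le_rfl)
        · exact add_nonneg (han x hx).meromorphicOrderAt_nonneg
            (han _ hxw).meromorphicOrderAt_nonneg
    · simp only [Pi.mul_apply]
      rw [hper z l hl, add_right_comm, hper _ l hl]
  have h12 : L.ω₁ / 2 + L.ω₂ / 2 ∉ L.lattice := by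
    have := L.mul_ω₁_add_mul_ω₂_mem_lattice (α := 1 / 2) (β := 1 / 2)
    intro h
    have h' := this.1 (by convert! h using 1; push_cast; ring)
    exact absurd h'.1 (by norm_num)
  obtain ⟨c1, hc1⟩ := key (L.ω₁ / 2) L.ω₁_div_two_notMem_lattice
    (by simpa using L.ω₁_mem_lattice)
  obtain ⟨c2, hc2⟩ := key (L.ω₂ / 2) L.ω₂_div_two_notMem_lattice
    (by simpa using L.ω₂_mem_lattice)
  obtain ⟨c3, hc3⟩ := key _ h12 (by
    rw [show L.ω₁ / 2 + L.ω₂ / 2 + (L.ω₁ / 2 + L.ω₂ / 2) = L.ω₁ + L.ω₂ by ring]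
    exact add_mem L.ω₁_mem_lattice L.ω₂_mem_lattice)
  -- Otherwise `o` would vanish identically near some point, whereas its order is finite everywhere.
  have hc2' : c2 ≠ 0 := by
    rintro rfl
    have h1 : meromorphicOrderAt (o * fun z => o (z + L.ω₂ / 2)) 0 = ⊤ :=
      meromorphicOrderAt_eq_top_iff.2 (hc2 0)
    rw [meromorphicOrderAt_mul (hm 0) (meromorphicAt_comp_add (hm _)),
      meromorphicOrderAt_comp_add, WithTop.add_eq_top] at h1
    exact h1.elim (hne _) (hne _)
  -- With ω = ω₁/2 and ω' = ω₂/2, the products o(z)o(z+ω) = c1, o(z)o(z+ω+ω') = c3 and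
  -- o(z+ω)o(z+ω+ω') = c2 give o(z)² c2 = c1 c3. A constant square contradicts the double pole of
  -- o².
  have hsq : (o * o) =ᶠ[𝓝[≠] 0] fun _ => c1 * c3 / c2 := by
    have h2 := (tendsto_add_punctured 0 (L.ω₁ / 2)).eventually (hc2 (0 + L.ω₁ / 2))
    filter_upwards [hc1 0, hc3 0, h2] with z h1 h3 h2
    rw [Pi.mul_apply, eq_div_iff hc2', ← h1, ← h3, ← h2, ← add_assoc]
    ring
  have h1 := meromorphicOrderAt_congr hsq
  rw [meromorphicOrderAt_mul (hm 0) (hm 0), hord] at h1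
  have h2 := (analyticAt_const (v := c1 * c3 / c2) (x := (0 : ℂ)) (𝕜 := ℂ)).meromorphicOrderAt_nonneg
  rw [← h1] at h2
  exact absurd h2 (by decide)

/-- The residue of an elliptic function with at most simple poles at the lattice points is zero. -/
theorem residue_eq_zero {a : ℤ → ℂ} (hol : DifferentiableOn ℂ g (L.lattice : Set ℂ)ᶜ)
    (hper : ∀ z ∉ L.lattice, ∀ l ∈ L.lattice, g (z + l) = g z)
    (hl : IsLaurentExpansionAtZero g a) (ha : ∀ n < -1, a n = 0) : a (-1) = 0 := by
  classical
  by_contra hne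
  -- Antisymmetrising doubles the residue. The value 0 on the lattice makes oddness and periodicity
  -- hold at every point.
  set o : ℂ → ℂ := fun z => if z ∈ L.lattice then 0 else g z - g (-z) with ho
  have e : o =ᶠ[𝓝[≠] 0] fun z => g z + (-1) * g (z / (-1)) := by
    filter_upwards [eventually_notMem_lattice L 0] with z hz
    simp [ho, hz, sub_eq_add_neg, div_neg]
  have hlo := (hl.add ((hl.comp_div (c := -1) (by simp)).const_mul (-1))).congr e
  have ha' : ∀ n < -1, a n + -1 * (a n * (-1) ^ (-n)) = 0 := fun n hn => by simp [ha n hn]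
  obtain ⟨F, hF, hoF⟩ := (isLaurentExpansionAtZero_iff ha').1 hlo
  refine meromorphicOrderAt_ne_neg_one_of_odd (L := L) (o := o) ?_ ?_ ?_ ?_
  · refine DifferentiableOn.congr (f := fun z => g z - g (-z)) ?_ fun z hz => ?_
    · refine hol.sub (hol.comp (differentiableOn_neg _) fun z hz => ?_)
      simpa using hz
    · simp only [ho]
      exact if_neg hz
  · intro z l hl
    have h1 : z + l ∈ L.lattice ↔ z ∈ L.lattice := Submodule.add_mem_iff_left _ hl
    simp only [ho, h1]
    split_ifs with hz
    · rfl
    · rw [hper z hz l hl, neg_add, hper (-z) (by simpa using hz) _ (neg_mem hl)]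
  · intro z
    simp only [ho, neg_mem_iff, neg_neg]
    split_ifs <;> simp
  · have hm := (hlo.meromorphicOrderAt_ge ha').1
    rw [meromorphicOrderAt_eq_int_iff hm]
    refine ⟨F, hF.analyticAt, ?_, by simpa using hoF⟩
    have := hF.coeff_zero 1
    rw [← this]
    simpa using hne

end Elliptic

/-! ### Holomorphy at the cusp and level one modular forms -/

theorem qParam_one_pow (τ : ℍ) (r : ℕ) :
    Function.Periodic.qParam 1 (τ : ℂ) ^ r = Complex.exp (2 * Real.pi * Complex.I * r * (τ : ℂ)) := by
  rw [Function.Periodic.qParam, ← Complex.exp_nat_mul]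
  congr 1
  push_cast
  ring

/-- Holomorphy at infinity means being `1`-periodic and bounded near infinity. -/
theorem isHolomorphicWithCusp_iff {A : ℍ → ℂ} :
    IsHolomorphicWithCusp A ↔ MDifferentiable 𝓘(ℂ) 𝓘(ℂ) A ∧ IsBoundedAtImInfty A ∧
      ∀ τ : ℍ, A ((1 : ℝ) +ᵥ τ) = A τ := by
  constructor
  · rintro ⟨h1, c, hc⟩
    refine ⟨h1, isBoundedAtImInfty_of_hasSum_qExpansion (h := 1) (c := c) one_pos fun τ => ?_,
      fun τ => ?_⟩
    · simpa only [qParam_one_pow, smul_eq_mul] using hc τ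
    · refine (hc _).unique ?_
      convert! hc τ using 3 with r
      rw [coe_vadd, Complex.exp_eq_exp_iff_exists_int]
      exact ⟨r, by push_cast; ring⟩
  · rintro ⟨h1, h2, h3⟩
    refine ⟨h1, fun m => (qExpansion 1 A).coeff m, fun τ => ?_⟩
    have hper : Function.Periodic (A ∘ ofComplex) ((1 : ℝ) : ℂ) := by
      intro w
      by_cases! hw : 0 < w.im
      · have : 0 < (w + (1 : ℝ)).im := by simp [hw]
        simp only [Function.comp_apply, ofComplex_apply_of_im_pos this,
          ofComplex_apply_of_im_pos hw]
        rw [← h3 ⟨w, hw⟩]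
        congr 1
        ext
        simp [add_comm]
      -- Outside the upper half-plane `ofComplex` has a fixed default value, so periodicity is
      -- trivial there.
      · have : (w + (1 : ℝ)).im ≤ 0 := by simpa using hw
        simp only [Function.comp_apply, ofComplex_apply_of_im_nonpos this,
          ofComplex_apply_of_im_nonpos hw]
    have := hasSum_qExpansion one_pos hper h1 h2 τ
    simpa only [qParam_one_pow, smul_eq_mul] using this

theorem IsHolomorphicWithCusp.mul {A B : ℍ → ℂ} (hA : IsHolomorphicWithCusp A)
    (hB : IsHolomorphicWithCusp B) : IsHolomorphicWithCusp (fun τ => A τ * B τ) := by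
  rw [isHolomorphicWithCusp_iff] at *
  exact ⟨hA.1.mul hB.1, hA.2.1.mul hB.2.1, fun τ => by rw [hA.2.2, hB.2.2]⟩

theorem IsHolomorphicWithCusp.const (t : ℂ) : IsHolomorphicWithCusp (fun _ => t) := by
  rw [isHolomorphicWithCusp_iff]
  exact ⟨mdifferentiable_const, Filter.const_boundedAtFilter _ t, fun _ => rfl⟩

theorem isHolomorphicWithCusp_modularForm {k : ℤ} (h : ModularForm 𝒮ℒ k) :
    IsHolomorphicWithCusp h := by
  refine ⟨ModularFormClass.holo h, fun m => (qExpansion 1 h).coeff m, fun τ => ?_⟩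
  have := ModularForm.hasSum_qExpansion (f := h) one_pos one_mem_strictPeriods_SL τ
  simpa only [qParam_one_pow] using this

/-- The factor of automorphy `cτ + d`. -/
def automorphyFactor (g : SL(2, ℤ)) (τ : ℍ) : ℂ := ((g 1 0 : ℤ) : ℂ) * τ + ((g 1 1 : ℤ) : ℂ)

theorem denom_eq_automorphyFactor (g : SL(2, ℤ)) (τ : ℍ) : denom g τ = automorphyFactor g τ :=
  ModularGroup.denom_apply g τ

theorem automorphyFactor_ne_zero (g : SL(2, ℤ)) (τ : ℍ) : automorphyFactor g τ ≠ 0 := by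
  rw [← denom_eq_automorphyFactor]
  exact denom_ne_zero _ τ

theorem coe_smul_eq (g : SL(2, ℤ)) (τ : ℍ) : ((g • τ : ℍ) : ℂ) =
    (((g 0 0 : ℤ) : ℂ) * τ + ((g 0 1 : ℤ) : ℂ)) / automorphyFactor g τ := by
  rw [coe_specialLinearGroup_apply]
  simp [automorphyFactor]

theorem modularForm_smul_apply {k : ℤ} (h : ModularForm 𝒮ℒ k) (g : SL(2, ℤ)) (τ : ℍ) :
    h (g • τ) = automorphyFactor g τ ^ k * h τ := by
  rw [← denom_eq_automorphyFactor]
  exact SlashInvariantForm.slash_action_eqn'' (Γ := 𝒮ℒ) h (γ := (g : GL (Fin 2) ℝ)) ⟨g, rfl⟩ τ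

open scoped ModularForm in
/-- A function which is holomorphic on the upper half-plane and at infinity and which transforms
like a modular form is a modular form. -/
def toModularForm {A : ℍ → ℂ} (k : ℤ) (hA : IsHolomorphicWithCusp A)
    (h : ∀ (g : SL(2, ℤ)) (τ : ℍ), A (g • τ) = automorphyFactor g τ ^ k * A τ) :
    ModularForm 𝒮ℒ k :=
  have hs : ∀ γ : SL(2, ℤ), A ∣[k] γ = A := fun γ => by
    ext τ
    rw [ModularForm.SL_slash_apply, h, denom_eq_automorphyFactor, zpow_neg]
    field_simp [zpow_ne_zero k (automorphyFactor_ne_zero γ τ)]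
  { toFun := A
    slash_action_eq' := fun _ ⟨γ, hγ⟩ => hγ ▸ hs γ
    holo' := hA.1
    -- Every cusp is an SL(2, ℤ)-translate of ∞, and `A` is invariant under the slash action, so
    -- boundedness at ∞ suffices.
    bdd_at_cusps' := fun {c} hc => by
      rw [Subgroup.IsArithmetic.isCusp_iff_isCusp_SL2Z] at hc
      rw [OnePoint.isBoundedAt_iff_forall_SL2Z hc]
      intro γ _
      rw [hs γ]
      exact (isHolomorphicWithCusp_iff.1 hA).2.1 }

/-! ### The lattice of τ and its Eisenstein series -/

/-- The pair of periods `(τ, 1)`. -/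
def periodPair (τ : ℍ) : PeriodPair where
  ω₁ := τ
  ω₂ := 1
  indep := by
    rw [LinearIndependent.pair_iff]
    intro s t h
    have h1 := congrArg Complex.im h
    have h2 := congrArg Complex.re h
    simp only [Complex.real_smul, Complex.add_im, Complex.mul_im, Complex.ofReal_re,
      Complex.ofReal_im, zero_mul, add_zero, Complex.one_im, mul_zero, Complex.zero_im,
      coe_im] at h1
    have hs : s = 0 := by
      rcases mul_eq_zero.1 h1 with h | h
      · exact h
      · exact absurd h τ.im_pos.ne'
    subst hs
    refine ⟨rfl, by simpa using h2⟩

theorem mem_periodPair_lattice {τ : ℍ} {w : ℂ} :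
    w ∈ (periodPair τ).lattice ↔ w ∈ lattice τ := by
  rw [PeriodPair.mem_lattice]
  simp only [periodPair, mul_one, lattice, Set.mem_ofPred_eq, eq_comm]

theorem coe_periodPair_lattice (τ : ℍ) :
    ((periodPair τ).lattice : Set ℂ) = lattice τ := by
  ext w
  exact mem_periodPair_lattice

/-- Sorting the lattice vectors by the gcd of their coordinates produces the zeta factor; the 2
undoes the factor 1/2 in `ModularForm.E`. This is what makes the coefficients of ℘ holomorphic at
infinity. -/
theorem G_periodPair {k : ℕ} (hk : 3 ≤ k) (τ : ℍ) :
    (periodPair τ).G k = 2 * riemannZeta k * ModularForm.E hk τ := by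
  have h1 : (periodPair τ).G k = ∑' v : Fin 2 → ℤ, EisensteinSeries.eisSummand k v τ := by
    rw [PeriodPair.G, ← (finTwoArrowEquiv ℤ).symm.tsum_eq,
      ← ((periodPair τ).latticeEquivProd.symm.toEquiv).tsum_eq]
    refine tsum_congr fun v => ?_
    simp only [LinearEquiv.coe_toEquiv, PeriodPair.latticeEquiv_symm_apply]
    simp [EisensteinSeries.eisSummand, periodPair]
  rw [h1, tsum_eisSummand_eq_riemannZeta_mul_eisensteinSeries hk,
    show ModularForm.E hk τ = (1 / 2 : ℂ) • EisensteinSeries.eisensteinSeriesSIF (N := 1) 0 k τ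
      from rfl, EisensteinSeries.eisensteinSeriesSIF_apply, smul_eq_mul]
  ring

theorem isHolomorphicWithCusp_G {k : ℕ} (hk : 3 ≤ k) :
    IsHolomorphicWithCusp (fun τ => (periodPair τ).G k) := by
  simp only [G_periodPair hk]
  exact (isHolomorphicWithCusp_modularForm _).smul _

theorem mul_add_mem_lattice (τ : ℍ) (l u : ℤ) : (l : ℂ) * τ + u ∈ lattice τ := ⟨l, u, rfl⟩

theorem div_automorphyFactor_mem_lattice_iff (g : SL(2, ℤ)) (τ : ℍ) (w : ℂ) :
    w / automorphyFactor g τ ∈ lattice (g • τ) ↔ w ∈ lattice τ := by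
  have hj := automorphyFactor_ne_zero g τ
  have hdet : (g 0 0 : ℤ) * g 1 1 - g 0 1 * g 1 0 = 1 := by
    rw [← Matrix.det_fin_two, g.det_coe]
  have hdet' : ((g 0 0 : ℤ) : ℂ) * (g 1 1 : ℤ) - (g 0 1 : ℤ) * (g 1 0 : ℤ) = 1 := by
    exact_mod_cast hdet
  constructor
  · rintro ⟨m, n, h⟩
    refine ⟨m * g 0 0 + n * g 1 0, m * g 0 1 + n * g 1 1, ?_⟩
    rw [coe_smul_eq, div_eq_iff hj] at h
    rw [h]
    field_simp
    simp only [automorphyFactor]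
    push_cast
    ring
  · rintro ⟨m, n, rfl⟩
    -- The new coordinates come from the inverse matrix, which is integral because the determinant
    -- is 1.
    refine ⟨m * g 1 1 - n * g 1 0, n * g 0 0 - m * g 0 1, ?_⟩
    rw [coe_smul_eq]
    field_simp
    simp only [automorphyFactor]
    push_cast
    linear_combination (-(m : ℂ) * τ - n) * hdet'

/-! ### Jacobi forms of index 0 through their Laurent coefficients -/

/-- `f` transforms like a Jacobi form of weight `k` and index `0`, and it has the Laurent
coefficients `A`, which are holomorphic on the upper half-plane and at infinity. -/
structure HasJacobiExpansion (k : ℕ) (f : ℍ → ℂ → ℂ) (A : ℤ → ℍ → ℂ) : Prop where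
  holomorphic : ∀ τ : ℍ, DifferentiableOn ℂ (f τ) (lattice τ)ᶜ
  transform : ∀ (g : SL(2, ℤ)) (τ : ℍ), ∀ z ∉ lattice τ,
    f (g • τ) (z / automorphyFactor g τ) = automorphyFactor g τ ^ k * f τ z
  periodic : ∀ τ : ℍ, ∀ z ∉ lattice τ, ∀ w ∈ lattice τ, f τ (z + w) = f τ z
  laurent : ∀ τ : ℍ, IsLaurentExpansionAtZero (f τ) (fun n => A n τ)
  cusp : ∀ n : ℤ, IsHolomorphicWithCusp (A n)

theorem eventually_notMem (τ : ℍ) (x : ℂ) : ∀ᶠ z in 𝓝[≠] x, z ∉ lattice τ := by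
  simpa only [mem_periodPair_lattice] using eventually_notMem_lattice (periodPair τ) x

theorem isOpen_compl (τ : ℍ) : IsOpen ((lattice τ)ᶜ) := by
  rw [← coe_periodPair_lattice]
  exact isOpen_compl_lattice _

namespace HasJacobiExpansion

variable {k : ℕ} {f : ℍ → ℂ → ℂ} {A : ℤ → ℍ → ℂ}

/-- The substitution z ↦ z/(cτ+d) multiplies the n-th coefficient by (cτ+d)^(-n); uniqueness of
Laurent expansions then shifts the weight from k to k + n. -/
theorem coeff_smul (h : HasJacobiExpansion k f A) (n : ℤ) (g : SL(2, ℤ)) (τ : ℍ) :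
    A n (g • τ) = automorphyFactor g τ ^ ((k : ℤ) + n) * A n τ := by
  have hj := automorphyFactor_ne_zero g τ
  have h1 := (h.laurent (g • τ)).comp_div hj
  have h2 := (h.laurent τ).const_mul (automorphyFactor g τ ^ k)
  have e : (fun z => f (g • τ) (z / automorphyFactor g τ)) =ᶠ[𝓝[≠] 0]
      fun z => automorphyFactor g τ ^ k * f τ z := by
    filter_upwards [eventually_notMem τ 0] with z hz using h.transform g τ z hz
  have h3 := congrFun (h1.unique (h2.congr e)) n
  simp only [zpow_neg] at h3
  rw [← div_eq_mul_inv, div_eq_iff (zpow_ne_zero n hj)] at h3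
  rw [h3, zpow_add₀ hj, zpow_natCast]
  ring

/-- The Laurent coefficients of a singular Jacobi form are modular forms. -/
def coeffForm (h : HasJacobiExpansion k f A) (n : ℤ) : ModularForm 𝒮ℒ ((k : ℤ) + n) :=
  toModularForm _ (h.cusp n) (h.coeff_smul n)

/-- The coefficient has negative weight k + n. This bounds the pole orders by k for all τ at once.
-/
theorem coeff_eq_zero (h : HasJacobiExpansion k f A) {n : ℤ} (hn : n < -k) : A n = 0 := by
  exact ModularFormClass.levelOne_neg_weight_eq_zero (by omega) (h.coeffForm n)

theorem isSingularJacobiForm (h : HasJacobiExpansion k f A) : IsSingularJacobiForm k 0 f where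
  singular :=
    { periodic_z := fun τ z hz => by
        simpa using h.periodic τ z hz _ (mul_add_mem_lattice τ 0 1)
      holomorphic_off_lattice := h.holomorphic
      poles_on_lattice := by
        refine ⟨k, fun τ w hw => ?_⟩
        have hper : ∀ z ∉ (periodPair τ).lattice, ∀ l ∈ (periodPair τ).lattice,
            f τ (z + l) = f τ z := by
          simpa only [mem_periodPair_lattice] using h.periodic τ
        rw [← mem_periodPair_lattice] at hw
        have h0 := (h.laurent τ).meromorphicOrderAt_ge (M := -(k : ℤ))
          fun n hn => by rw [h.coeff_eq_zero hn, Pi.zero_apply]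
        exact ⟨meromorphicAt_of_periodic hper h0.1 hw,
          h0.2.trans_eq (meromorphicOrderAt_of_periodic hper hw).symm⟩
      periodic_tau := fun τ z hz => by
        have := h.transform ModularGroup.T τ z hz
        rw [modular_T_smul] at this
        simpa [automorphyFactor, ModularGroup.T] using this
      laurent_coefficients := ⟨A, h.laurent, h.cusp⟩ }
  slash_eq g l u τ z hz := by
    have hw := mul_add_mem_lattice τ l u
    have hz' : z + ((l : ℂ) * τ + u) ∉ lattice τ := fun h' => hz (by
      rw [← mem_periodPair_lattice] at *
      exact (Submodule.add_mem_iff_left _ hw).1 h')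
    have h1 := h.transform g τ _ hz'
    rw [h.periodic τ z hz _ hw] at h1
    simp only [jacobiSlash, add_assoc, Nat.cast_zero, mul_zero, zero_mul, Complex.exp_zero, mul_one]
    simp only [automorphyFactor] at h1
    rw [h1, zpow_neg, zpow_natCast, inv_mul_cancel_left₀]
    exact pow_ne_zero k (automorphyFactor_ne_zero g τ)

theorem add {f' : ℍ → ℂ → ℂ} {A' : ℤ → ℍ → ℂ} (h : HasJacobiExpansion k f A)
    (h' : HasJacobiExpansion k f' A') :
    HasJacobiExpansion k (fun τ z => f τ z + f' τ z) (fun n τ => A n τ + A' n τ) where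
  holomorphic τ := (h.holomorphic τ).add (h'.holomorphic τ)
  transform g τ z hz := by rw [h.transform g τ z hz, h'.transform g τ z hz, mul_add]
  periodic τ z hz w hw := by rw [h.periodic τ z hz w hw, h'.periodic τ z hz w hw]
  laurent τ := (h.laurent τ).add (h'.laurent τ)
  cusp n := (h.cusp n).add (h'.cusp n)

theorem zero : HasJacobiExpansion k (fun _ _ => 0) (fun _ _ => 0) where
  holomorphic τ := differentiableOn_const _
  transform g τ z hz := by rw [mul_zero]
  periodic τ z hz w hw := rfl
  laurent τ := IsLaurentExpansionAtZero.zero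
  cusp n := IsHolomorphicWithCusp.zero

theorem sum {ι : Type*} (s : Finset ι) {F : ι → ℍ → ℂ → ℂ} {B : ι → ℤ → ℍ → ℂ}
    (h : ∀ i ∈ s, HasJacobiExpansion k (F i) (B i)) :
    HasJacobiExpansion k (fun τ z => ∑ i ∈ s, F i τ z) (fun n τ => ∑ i ∈ s, B i n τ) := by
  classical
  induction s using Finset.induction_on with
  | empty => simpa using zero
  | insert i s hi ih =>
    simp only [Finset.sum_insert hi]
    exact (h i (by simp)).add (ih fun j hj => h j (by simp [hj]))

theorem modularForm_mul (h : HasJacobiExpansion k f A) {m : ℕ} (F : ModularForm 𝒮ℒ (m : ℤ)) :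
    HasJacobiExpansion (m + k) (fun τ z => F τ * f τ z) (fun n τ => F τ * A n τ) where
  holomorphic τ := (h.holomorphic τ).const_mul _
  transform g τ z hz := by
    rw [h.transform g τ z hz, modularForm_smul_apply, zpow_natCast, pow_add]
    ring
  periodic τ z hz w hw := by rw [h.periodic τ z hz w hw]
  laurent τ := (h.laurent τ).const_mul _
  cusp n := (isHolomorphicWithCusp_modularForm F).mul (h.cusp n)

theorem const_mul (h : HasJacobiExpansion k f A) (t : ℂ) :
    HasJacobiExpansion k (fun τ z => t * f τ z) (fun n τ => t * A n τ) where
  holomorphic τ := (h.holomorphic τ).const_mul _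
  transform g τ z hz := by rw [h.transform g τ z hz, mul_left_comm]
  periodic τ z hz w hw := by rw [h.periodic τ z hz w hw]
  laurent τ := (h.laurent τ).const_mul _
  cusp n := (h.cusp n).smul t

/-- Since the index is 0, no exponential factor interferes: the chain rule in z contributes exactly
one more factor cτ + d. -/
theorem deriv (h : HasJacobiExpansion k f A) :
    HasJacobiExpansion (k + 1) (fun τ => deriv (f τ))
      (fun n τ => ((n : ℂ) + 1) * A (n + 1) τ) where
  holomorphic τ := (h.holomorphic τ).deriv (isOpen_compl τ)
  transform g τ z hz := by
    have hj := automorphyFactor_ne_zero g τ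
    have e : (fun y => f (g • τ) ((automorphyFactor g τ)⁻¹ * y)) =ᶠ[𝓝 z]
        fun y => automorphyFactor g τ ^ k * f τ y := by
      filter_upwards [(isOpen_compl τ).mem_nhds hz] with y hy
      rw [mul_comm, ← div_eq_mul_inv]
      exact h.transform g τ y hy
    have h1 := e.deriv_eq
    rw [deriv_comp_mul_left, deriv_const_mul_field, smul_eq_mul, mul_comm _ z,
      ← div_eq_mul_inv, inv_mul_eq_iff_eq_mul₀ hj] at h1
    rw [h1, pow_succ]
    ring
  periodic τ z hz w hw := by
    have e : (fun y => f τ (y + w)) =ᶠ[𝓝 z] f τ := by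
      filter_upwards [(isOpen_compl τ).mem_nhds hz] with y hy using h.periodic τ y hy w hw
    rw [← e.deriv_eq, deriv_comp_add_const]
  laurent τ := (h.laurent τ).deriv
  cusp n := (h.cusp (n + 1)).smul _

theorem one : HasJacobiExpansion 0 (fun _ _ => 1) (fun n _ => if n = 0 then 1 else 0) where
  holomorphic τ := differentiableOn_const _
  transform g τ z hz := by simp
  periodic τ z hz w hw := rfl
  laurent τ := by
    refine ⟨⟨0, fun n hn => if_neg hn.ne⟩, .of_forall fun z => ?_⟩
    convert! hasSum_single (f := fun n : ℤ => (if n = 0 then (1 : ℂ) else 0) * z ^ n) 0 ?_ using 1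
    · simp
    · intro n hn
      simp [hn]
  cusp n := IsHolomorphicWithCusp.const _

end HasJacobiExpansion

/-- The action of the Jacobi group is split into its two factors, taking (l, u) = (0, 0) for the
modular law and g = 1 for periodicity. -/
theorem IsSingularJacobiForm.exists_hasJacobiExpansion {k : ℕ} {f : ℍ → ℂ → ℂ}
    (h : IsSingularJacobiForm k 0 f) : ∃ A, HasJacobiExpansion k f A := by
  obtain ⟨A, hA, hc⟩ := h.singular.laurent_coefficients
  refine ⟨A, h.singular.holomorphic_off_lattice, fun g τ z hz => ?_, fun τ z hz w hw => ?_, hA, hc⟩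
  · have h1 := h.slash_eq g 0 0 τ z hz
    simp only [jacobiSlash, Nat.cast_zero, mul_zero, zero_mul, Complex.exp_zero, mul_one,
      Int.cast_zero, add_zero, zpow_neg, zpow_natCast] at h1
    exact (inv_mul_eq_iff_eq_mul₀ (pow_ne_zero k (automorphyFactor_ne_zero g τ))).1 h1
  · obtain ⟨l, u, rfl⟩ := hw
    have h1 := h.slash_eq 1 l u τ z hz
    simpa [jacobiSlash, ← add_assoc] using h1

/-! ### The Weierstrass function and forms with prescribed principal part -/

/-- The Laurent coefficients at `0` of the Weierstrass function. -/
def weierstrassPCoeff (n : ℤ) (τ : ℍ) : ℂ :=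
  if n = -2 then 1 else if n ≤ 0 then 0 else ((n : ℂ) + 1) * (periodPair τ).G (n + 2).toNat

/-- Division by cτ + d maps the lattice of τ bijectively onto that of g • τ, and every summand of ℘
is homogeneous of degree -2. -/
theorem weierstrassP_smul (g : SL(2, ℤ)) (τ : ℍ) (z : ℂ) :
    (periodPair (g • τ)).weierstrassP (z / automorphyFactor g τ) =
      automorphyFactor g τ ^ 2 * (periodPair τ).weierstrassP z := by
  have hj := automorphyFactor_ne_zero g τ
  let e : (periodPair τ).lattice ≃ (periodPair (g • τ)).lattice :=
    (Equiv.mulRight₀ (automorphyFactor g τ)⁻¹ (inv_ne_zero hj)).subtypeEquiv fun w => by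
      rw [mem_periodPair_lattice, mem_periodPair_lattice,
        ← div_automorphyFactor_mem_lattice_iff g, div_eq_mul_inv]
      rfl
  have he : ∀ l, ((e l : (periodPair (g • τ)).lattice) : ℂ) = l / automorphyFactor g τ :=
    fun l => (div_eq_mul_inv _ _).symm
  rw [PeriodPair.weierstrassP, PeriodPair.weierstrassP, ← e.tsum_eq, ← tsum_mul_left]
  refine tsum_congr fun l => ?_
  rw [he, ← sub_div, div_pow, div_pow, one_div_div, one_div_div]
  ring

theorem isLaurentExpansionAtZero_weierstrassP (τ : ℍ) :
    IsLaurentExpansionAtZero (periodPair τ).weierstrassP (fun n => weierstrassPCoeff n τ) := by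
  have h1 := (periodPair τ).hasFPowerSeriesAt_weierstrassPExcept 0
  have h2 : IsLaurentExpansionAtZero ((periodPair τ).weierstrassPExcept 0) (fun n : ℤ =>
      if n ≤ 0 then 0 else ((n : ℂ) + 1) * (periodPair τ).G (n + 2).toNat) := by
    refine (isLaurentExpansionAtZero_iff (M := 0) fun n hn => if_pos hn.le).2
      ⟨(periodPair τ).weierstrassPExcept 0, ?_, ?_⟩
    · convert! h1 using 2
      funext i
      rcases i with _ | i
      · simp
      · rw [if_neg (by push_cast; omega), if_neg (by omega), PeriodPair.sumInvPow_zero]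
        congr 2
        · push_cast; ring
        · omega
    · simp
  have h3 : IsLaurentExpansionAtZero (fun z : ℂ => 1 / z ^ 2)
      (fun n : ℤ => if n = -2 then 1 else 0) := by
    refine ⟨⟨-2, fun n hn => if_neg hn.ne⟩, .of_forall fun z => ?_⟩
    have e : 1 / z ^ 2 = (if (-2 : ℤ) = -2 then (1 : ℂ) else 0) * z ^ (-2 : ℤ) := by
      rw [if_pos rfl, one_mul, zpow_neg, one_div, zpow_ofNat]
    beta_reduce
    rw [e]
    exact hasSum_single (f := fun n : ℤ => (if n = -2 then (1 : ℂ) else 0) * z ^ n) (-2)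
      fun n hn => by simp only [if_neg hn, zero_mul]
  convert! h2.add h3 using 1
  · funext z
    have := (periodPair τ).weierstrassPExcept_add 0 z
    simpa using this.symm
  · funext n
    simp only [weierstrassPCoeff]
    split_ifs <;> first | omega | simp

theorem hasJacobiExpansion_weierstrassP :
    HasJacobiExpansion 2 (fun τ => (periodPair τ).weierstrassP) weierstrassPCoeff where
  holomorphic τ := by
    rw [← coe_periodPair_lattice]
    exact (periodPair τ).differentiableOn_weierstrassP
  transform g τ z _ := weierstrassP_smul g τ z
  periodic τ z _ w hw :=
    (periodPair τ).weierstrassP_add_coe z ⟨w, mem_periodPair_lattice.2 hw⟩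
  laurent := isLaurentExpansionAtZero_weierstrassP
  cusp n := by
    unfold weierstrassPCoeff
    by_cases h2 : n = -2
    · simpa only [if_pos h2] using IsHolomorphicWithCusp.const 1
    · by_cases h0 : n ≤ 0
      · simpa only [if_neg h2, if_pos h0] using IsHolomorphicWithCusp.const 0
      · have := (isHolomorphicWithCusp_G (k := (n + 2).toNat) (by omega)).smul ((n : ℂ) + 1)
        simpa only [if_neg h2, if_neg h0] using this

/-- For each `N ≠ 1` there is a singular Jacobi form of weight `N` with principal part `z⁻ᴺ`. -/
theorem exists_principal_part (N : ℕ) : ∃ (φ : ℍ → ℂ → ℂ) (B : ℤ → ℍ → ℂ), N ≠ 1 →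
    HasJacobiExpansion N φ B ∧ (∀ τ, B (-N) τ = 1) ∧ ∀ n < 0, n ≠ -(N : ℤ) → ∀ τ, B n τ = 0 := by
  rcases N with _ | _ | N
  · exact ⟨_, _, fun _ => ⟨HasJacobiExpansion.one, fun τ => by simp, fun n hn _ τ => if_neg hn.ne⟩⟩
  · exact ⟨fun _ _ => 0, fun _ _ => 0, fun h => absurd rfl h⟩
  · induction N with
    | zero =>
      refine ⟨_, _, fun _ => ⟨hasJacobiExpansion_weierstrassP, fun τ => ?_, fun n hn hn' τ => ?_⟩⟩
      · simp [weierstrassPCoeff]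
      · have : n ≠ -2 := hn'
        simp [weierstrassPCoeff, this, hn.le]
    | succ N ih =>
      obtain ⟨φ, B, h⟩ := ih
      obtain ⟨h, h1, h0⟩ := h (by omega)
      -- The derivative of z^(-(N+2)) is -(N+2) z^(-(N+3)), which explains the constant.
      refine ⟨_, _, fun _ => ⟨h.deriv.const_mul (-((N : ℂ) + 2)⁻¹), fun τ => ?_,
        fun n hn hn' τ => ?_⟩⟩
      · have := h1 τ
        have hN : (N : ℂ) + 2 ≠ 0 := by exact_mod_cast (by omega : N + 2 ≠ 0)
        rw [show -((N + 1 + 1 + 1 : ℕ) : ℤ) + 1 = -((N + 1 + 1 : ℕ) : ℤ) by push_cast; ring, this]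
        push_cast
        field_simp
        ring
      -- For n = -1 the constant term of φ is involved, about which nothing is known, but its factor
      -- n + 1 vanishes.
      · rcases eq_or_ne n (-1) with rfl | hn1
        · simp
        · rw [h0 (n + 1) (by omega) (by push_cast at hn' ⊢; omega)]
          simp

/-! ### Decomposition into modular forms and the dimension count -/

theorem rank_modularForm (j : ℕ) :
    Module.rank ℂ (ModularForm 𝒮ℒ (j : ℤ)) = (modularDim j : Cardinal) := by
  rw [modularDim]
  split_ifs with h h2
  · rw [ModularForm.levelOne_odd_weight_rank_zero (by exact_mod_cast h), Nat.cast_zero]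
  all_goals
    rw [ModularForm.dimension_level_one j (Nat.not_odd_iff_even.1 h)]
    have e : j ≡ 2 [MOD 12] ↔ j % 12 = 2 := Iff.rfl
    simp only [e, h2, if_true, if_false]

instance finite_modularForm (j : ℕ) : Module.Finite ℂ (ModularForm 𝒮ℒ (j : ℤ)) := by
  rw [← Module.rank_lt_aleph0_iff, rank_modularForm]
  exact Cardinal.natCast_lt_aleph0

theorem finrank_modularForm (j : ℕ) :
    Module.finrank ℂ (ModularForm 𝒮ℒ (j : ℤ)) = modularDim j := by
  rw [Module.finrank, rank_modularForm, Cardinal.toNat_natCast]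

/-- The possible pole orders at the lattice points of a singular Jacobi form of weight `k`. -/
abbrev PoleOrder (k : ℕ) : Type := {N : ℕ // N ∈ (Finset.range (k + 1)).erase 1}

/-- The singular Jacobi form of weight `N` with principal part `z⁻ᴺ`. -/
def principalForm (N : ℕ) : ℍ → ℂ → ℂ := (exists_principal_part N).choose

/-- The Laurent coefficients of `principalForm N`. -/
def principalCoeff (N : ℕ) : ℤ → ℍ → ℂ := (exists_principal_part N).choose_spec.choose

theorem hasJacobiExpansion_principalForm {N : ℕ} (hN : N ≠ 1) :
    HasJacobiExpansion N (principalForm N) (principalCoeff N) :=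
  ((exists_principal_part N).choose_spec.choose_spec hN).1

theorem principalCoeff_self {N : ℕ} (hN : N ≠ 1) (τ : ℍ) : principalCoeff N (-N) τ = 1 :=
  ((exists_principal_part N).choose_spec.choose_spec hN).2.1 τ

theorem principalCoeff_eq_zero {N : ℕ} (hN : N ≠ 1) {n : ℤ} (hn : n < 0) (hn' : n ≠ -(N : ℤ))
    (τ : ℍ) : principalCoeff N n τ = 0 :=
  ((exists_principal_part N).choose_spec.choose_spec hN).2.2 n hn hn' τ

/-- The combination of the forms `principalForm N` with modular forms as coefficients. -/
def combination (k : ℕ) (h : (N : PoleOrder k) → ModularForm 𝒮ℒ ((k - N : ℕ) : ℤ)) (τ : ℍ)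
    (z : ℂ) : ℂ :=
  ∑ N, h N τ * principalForm N τ z

/-- The Laurent coefficients of `combination k h`. -/
def combinationCoeff (k : ℕ) (h : (N : PoleOrder k) → ModularForm 𝒮ℒ ((k - N : ℕ) : ℤ)) (n : ℤ)
    (τ : ℍ) : ℂ :=
  ∑ N : PoleOrder k, h N τ * principalCoeff N n τ

theorem PoleOrder.ne_one {k : ℕ} (N : PoleOrder k) : (N : ℕ) ≠ 1 := (Finset.mem_erase.1 N.2).1

theorem PoleOrder.le {k : ℕ} (N : PoleOrder k) : (N : ℕ) ≤ k :=
  Nat.lt_succ_iff.1 (Finset.mem_range.1 (Finset.mem_erase.1 N.2).2)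

variable {k : ℕ}

theorem hasJacobiExpansion_combination
    (h : (N : PoleOrder k) → ModularForm 𝒮ℒ ((k - N : ℕ) : ℤ)) :
    HasJacobiExpansion k (combination k h) (combinationCoeff k h) := by
  refine HasJacobiExpansion.sum Finset.univ fun N _ => ?_
  have := (hasJacobiExpansion_principalForm N.ne_one).modularForm_mul (h N)
  rwa [Nat.sub_add_cancel N.le] at this

/-- Among the φ_P only φ_N has a term z⁻ᴺ. The order 0 is excluded because the constant terms of the
other φ_P are not controlled. -/
theorem combinationCoeff_neg (h : (N : PoleOrder k) → ModularForm 𝒮ℒ ((k - N : ℕ) : ℤ))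
    (N : PoleOrder k) (hN : (N : ℕ) ≠ 0) (τ : ℍ) :
    combinationCoeff k h (-(N : ℕ)) τ = h N τ := by
  rw [combinationCoeff, Finset.sum_eq_single N]
  · rw [principalCoeff_self N.ne_one, mul_one]
  · intro P _ hP
    rw [principalCoeff_eq_zero P.ne_one (by omega), mul_zero]
    intro h
    exact hP (Subtype.ext (by omega))
  · simp

/-- The pole order `0`. -/
def zeroOrder (k : ℕ) : PoleOrder k := ⟨0, by simp⟩

theorem combinationCoeff_zero (h : (N : PoleOrder k) → ModularForm 𝒮ℒ ((k - N : ℕ) : ℤ))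
    (h0 : ∀ N : PoleOrder k, (N : ℕ) ≠ 0 → h N = 0) (τ : ℍ) :
    combinationCoeff k h 0 τ = h (zeroOrder k) τ := by
  rw [combinationCoeff, Finset.sum_eq_single (zeroOrder k)]
  · have := principalCoeff_self (N := 0) (by omega) τ
    rw [Nat.cast_zero, neg_zero] at this
    simp only [zeroOrder, this, mul_one]
  · intro P _ hP
    rw [h0 P fun h => hP (Subtype.ext h), zero_apply, zero_mul]
  · simp

theorem HasJacobiExpansion.coeff_unique {f f' : ℍ → ℂ → ℂ} {A A' : ℤ → ℍ → ℂ}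
    (h : HasJacobiExpansion k f A) (h' : HasJacobiExpansion k f' A')
    (e : ∀ τ, ∀ z ∉ lattice τ, f τ z = f' τ z) : A = A' := by
  funext n τ
  refine congrFun ((h.laurent τ).unique ((h'.laurent τ).congr ?_)) n
  filter_upwards [eventually_notMem τ 0] with z hz using e τ z hz

/-- A singular Jacobi form whose only possible poles are simple does not depend on `z`. -/
theorem HasJacobiExpansion.eq_coeff_zero {f : ℍ → ℂ → ℂ} {A : ℤ → ℍ → ℂ}
    (h : HasJacobiExpansion k f A) {τ : ℍ} (hA : ∀ n < -1, A n τ = 0) {z : ℂ}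
    (hz : z ∉ lattice τ) : f τ z = A 0 τ := by
  have hol : DifferentiableOn ℂ (f τ) ((periodPair τ).lattice : Set ℂ)ᶜ := by
    rw [coe_periodPair_lattice]
    exact h.holomorphic τ
  have hper : ∀ z ∉ (periodPair τ).lattice, ∀ l ∈ (periodPair τ).lattice,
      f τ (z + l) = f τ z := by
    simpa only [mem_periodPair_lattice] using h.periodic τ
  have hres : A (-1) τ = 0 := residue_eq_zero hol hper (h.laurent τ) hA
  have hA' : ∀ n < 0, A n τ = 0 := fun n hn => by
    rcases eq_or_ne n (-1) with rfl | h1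
    · exact hres
    · exact hA n (by omega)
  obtain ⟨hm, ho⟩ := (h.laurent τ).meromorphicOrderAt_ge hA'
  obtain ⟨c, hc⟩ := exists_eq_const_of_order_nonneg hol hper hm ho
  have hc' : IsLaurentExpansionAtZero (f τ) (fun n => c * if n = 0 then 1 else 0) := by
    refine ((HasJacobiExpansion.one.laurent τ).const_mul c).congr ?_
    filter_upwards [eventually_notMem_lattice (periodPair τ) 0] with y hy
    rw [hc y hy, mul_one]
  have := congrFun ((h.laurent τ).unique hc') 0
  rw [hc z (by rwa [mem_periodPair_lattice]), this]
  simp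

/-- The polar coefficients force every `h N` with N ≠ 0 to vanish; only then can `h 0` be read off
the constant term. -/
theorem eq_zero_of_combination_eq_zero
    (h : (N : PoleOrder k) → ModularForm 𝒮ℒ ((k - N : ℕ) : ℤ))
    (e : ∀ τ, ∀ z ∉ lattice τ, combination k h τ z = 0) : h = 0 := by
  have hc := (hasJacobiExpansion_combination h).coeff_unique HasJacobiExpansion.zero e
  have h0 : ∀ N : PoleOrder k, (N : ℕ) ≠ 0 → h N = 0 := fun N hN => by
    ext τ
    rw [← combinationCoeff_neg h N hN, hc]
    rfl
  funext N
  by_cases hN : (N : ℕ) = 0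
  · obtain rfl : N = zeroOrder k := Subtype.ext hN
    ext τ
    rw [← combinationCoeff_zero h h0, hc]
    rfl
  · exact h0 N hN

/-- Removing the polar part with the φ_N for N ≥ 2 leaves at most simple poles, hence a function of
τ alone. It equals its own constant Laurent coefficient and so is a modular form of weight k. -/
theorem exists_combination {f : ℍ → ℂ → ℂ} (hf : IsSingularJacobiForm k 0 f) :
    ∃ h : (N : PoleOrder k) → ModularForm 𝒮ℒ ((k - N : ℕ) : ℤ),
      ∀ τ, ∀ z ∉ lattice τ, f τ z = combination k h τ z := by
  obtain ⟨A, hA⟩ := hf.exists_hasJacobiExpansion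
  have hcoeff : ∀ {B : ℤ → ℍ → ℂ} {f : ℍ → ℂ → ℂ}, HasJacobiExpansion k f B → ∀ N : PoleOrder k,
      ∃ F : ModularForm 𝒮ℒ ((k - N : ℕ) : ℤ), ∀ τ, F τ = B (-(N : ℕ)) τ := by
    intro B f hB N
    refine ⟨toModularForm _ (hB.cusp _) fun g τ => ?_, fun τ => rfl⟩
    rw [hB.coeff_smul, Nat.cast_sub N.le, sub_eq_add_neg]
  choose F hF using hcoeff hA
  -- The component of order 0 is left empty, to be filled by the remainder.
  set h₁ := Function.update F (zeroOrder k) 0 with hh₁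
  have hsub := hA.add ((hasJacobiExpansion_combination h₁).const_mul (-1))
  choose F' hF' using hcoeff hsub
  have hpole : ∀ τ, ∀ n < -1, A n τ + -1 * combinationCoeff k h₁ n τ = 0 := by
    intro τ n hn
    by_cases hk : n < -k
    · rw [hA.coeff_eq_zero hk, (hasJacobiExpansion_combination h₁).coeff_eq_zero hk]
      simp
    · let N : PoleOrder k := ⟨(-n).toNat, by simp; omega⟩
      have hN : -((N : ℕ) : ℤ) = n := by simp only [N]; omega
      have hN0 : (N : ℕ) ≠ 0 := by omega
      have hNz : N ≠ zeroOrder k := fun h => hN0 (congrArg Subtype.val h)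
      have h1 := combinationCoeff_neg h₁ N hN0 τ
      rw [hN] at h1
      rw [h1, hh₁, Function.update_of_ne hNz, hF, hN]
      ring
  let h₂ : (N : PoleOrder k) → ModularForm 𝒮ℒ ((k - N : ℕ) : ℤ) :=
    Function.update 0 (zeroOrder k) (F' (zeroOrder k))
  refine ⟨h₁ + h₂, fun τ z hz => ?_⟩
  have h1 := hsub.eq_coeff_zero (hpole τ) hz
  have h2 := hF' (zeroOrder k) τ
  have h3 : combination k (h₁ + h₂) τ z =
      combination k h₁ τ z + F' (zeroOrder k) τ * principalForm 0 τ z := by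
    simp only [combination, Pi.add_apply, add_apply, add_mul, Finset.sum_add_distrib]
    congr 1
    rw [Finset.sum_eq_single (zeroOrder k)]
    · simp only [h₂, Function.update_self]
      rfl
    · intro P _ hP
      simp only [h₂, Function.update_of_ne hP, Pi.zero_apply, zero_apply, zero_mul]
    · simp
  -- `principalForm 0` is known only by its principal part and its constant term 1; having no poles,
  -- it equals that constant term.
  have h4 : principalForm 0 τ z = 1 := by
    have hp := hasJacobiExpansion_principalForm (N := 0) (by omega)
    rw [hp.eq_coeff_zero (fun n hn => principalCoeff_eq_zero (by omega) (by omega)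
      (by push_cast; omega) τ) hz]
    simpa using principalCoeff_self (N := 0) (by omega) τ
  have h5 : -((zeroOrder k : ℕ) : ℤ) = 0 := rfl
  rw [h5] at h2
  rw [h3, h4, h2, mul_one, ← h1]
  ring

variable (k) in
/-- Modular forms of weights `k - N` yield a singular Jacobi form of weight `k`. -/
def combinationMap :
    ((N : PoleOrder k) → ModularForm 𝒮ℒ ((k - N : ℕ) : ℤ)) →ₗ[ℂ] (PuncturedDomain → ℂ) where
  toFun h := restrict (combination k h)
  map_add' h h' := by
    ext p
    simp [restrict, combination, add_mul, Finset.sum_add_distrib]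
  map_smul' t h := by
    ext p
    simp [restrict, combination, mul_assoc, Finset.mul_sum]

theorem combinationMap_injective : Function.Injective (combinationMap k) := by
  rw [injective_iff_map_eq_zero]
  intro h hh
  exact eq_zero_of_combination_eq_zero h fun τ z hz => congrFun hh ⟨(τ, z), hz⟩

theorem range_combinationMap :
    LinearMap.range (combinationMap k) = singularJacobiForms k 0 := by
  ext p
  constructor
  · rintro ⟨h, rfl⟩
    exact ⟨combination k h, (hasJacobiExpansion_combination h).isSingularJacobiForm, rfl⟩
  · rintro ⟨f, hf, rfl⟩
    obtain ⟨h, hh⟩ := exists_combination hf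
    exact ⟨h, funext fun p => (hh p.1.1 p.1.2 p.2).symm⟩

variable (k) in
/-- Singular Jacobi forms are families of modular forms, one for each pole order. -/
def combinationEquiv :
    ((N : PoleOrder k) → ModularForm 𝒮ℒ ((k - N : ℕ) : ℤ)) ≃ₗ[ℂ] singularJacobiForms k 0 :=
  (LinearEquiv.ofInjective _ combinationMap_injective).trans
    (LinearEquiv.ofEq _ _ range_combinationMap)

instance finite_singularJacobiForms : Module.Finite ℂ (singularJacobiForms k 0) :=
  Module.Finite.equiv (combinationEquiv k)

theorem dS_eq_poleOrderDim (k : ℕ) : dS k = poleOrderDim k := by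
  rw [dS, ← (combinationEquiv k).finrank_eq, Module.finrank_pi_fintype]
  simp only [finrank_modularForm]
  exact Finset.sum_coe_sort _ fun N => modularDim (k - N)

end SingularJacobi

end

theorem proposition9 :
    (∀ k : ℕ, Module.Finite ℂ (SingularJacobi.singularJacobiForms k 0) ∧
      (SingularJacobi.dS k : ℤ) =
        SingularJacobi.nearestInt (((k : ℝ) + 3 * (SingularJacobi.eta k : ℝ)) ^ 2 / 48)) ∧
    (PowerSeries.mk (fun k : ℕ => (SingularJacobi.dS k : ℚ)) =
      ((1 - PowerSeries.X ^ 2) * (1 - PowerSeries.X ^ 3) * (1 - PowerSeries.X ^ 4))⁻¹) ∧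
    (∀ k : ℕ, SingularJacobi.dS (2 * k + 3) = SingularJacobi.dS (2 * k)) ∧
    (∀ k : ℕ, SingularJacobi.dS (2 * k + 13) = SingularJacobi.dS (2 * k + 1) + k + 5) ∧
    (SingularJacobi.dS 0 = 1 ∧ SingularJacobi.dS 1 = 0 ∧ SingularJacobi.dS 2 = 1 ∧
      SingularJacobi.dS 4 = 2 ∧ SingularJacobi.dS 6 = 3 ∧ SingularJacobi.dS 8 = 4 ∧
      SingularJacobi.dS 10 = 5 ∧ SingularJacobi.dS 12 = 7) := by
  simp only [SingularJacobi.dS_eq_poleOrderDim]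
  exact ⟨fun k => ⟨inferInstance, SingularJacobi.poleOrderDim_eq_nearestInt k⟩,
    SingularJacobi.mk_poleOrderDim, SingularJacobi.poleOrderDim_two_mul_add_three,
    SingularJacobi.poleOrderDim_two_mul_add_thirteen, by decide +kernel⟩
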